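/- Fix constants $\beta > 2$, $w_0 > 0$, $\lambda > 0$. The standard geometric inhomogeneous random graph $\mathrm{GIRG}(n,\beta,w_0,d)$ has $n$ vertices; each vertex $v$ independently receives a weight $w_v$ with Pareto distribution $\Pr(w_v \le x) = 1-(x/w_0)^{1-\beta}$ for $x \ge w_0$, and, independently, a uniformly random position $\mathbf{x}_v$ on the torus $\mathbb{T}^d = (\mathbb{R}/\mathbb{Z})^d$ equipped with the $L_\infty$-distance (the maximum over the coordinates of the circle distance). Distinct vertices $u,v$ are adjacent if and only if the distance of $\mathbf{x}_u$ and $\mathbf{x}_v$ is at most $\frac12\left(\frac{\lambda w_u w_v}{n}\right)^{1/d}$. Let $K_k$ be the number of $k$-cliques, i.e. of $k$-element vertex sets that are pairwise adjacent. Theorem. There are constants $a, A, b, B > 0$, depending only on $\beta, w_0, \lambda$, such that the following holds. Let $d = d(n) \ge 1$ and $k = k(n) \ge 3$ be integer sequences with $d = o(\log n)$ and, if $\beta = 3$, also $k = o(\log(n)/d)$. Then there is a sequence $r(n) \to 0$ such that, for all sufficiently large $n$: (i) if $\beta \ge 3$, or if $\beta < 3$ and $k < \frac{2}{3-\beta}$,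 then $$ n\, e^{-A d k} (Bk)^{-k} \;\le\; \mathbb{E}[K_k] - r(n) \;\le\; n\, e^{-a d k} (bk)^{-k}, $$ that is, $\mathbb{E}[K_k] = n \exp(-\Theta(1) d k)\,\Theta(k)^{-k} + o(1)$; (ii) if $\beta < 3$, $k > \frac{2}{3-\beta}$ and $k \le n$, then $$ n^{\frac{k}{2}(3-\beta)} (Bk)^{-k} \;\le\; \mathbb{E}[K_k] \;\le\; n^{\frac{k}{2}(3-\beta)} (bk)^{-k}, $$ that is, $\mathbb{E}[K_k] = n^{\frac{k}{2}(3-\beta)}\,\Theta(k)^{-k}$. -/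

import Mathlib

open MeasureTheory ProbabilityTheory Filter Topology Asymptotics

noncomputable section

/-- The `d`-dimensional torus. Its distance is the maximum over the coordinates of the circle
distance `min |s| (1 - |s|)`, and its `volume` is the uniform probability measure. -/
abbrev Torus (d : ℕ) : Type := Fin d → UnitAddCircle

/-- A sample of the vertex data: every vertex has a weight and a position on the torus. -/
abbrev GIRGSample (n d : ℕ) : Type := Fin n → ℝ × Torus d

/-- The law of the vertex data of `GIRG(n, β, w₀, d)`: all weights and positions are independent,
weights are Pareto with `P(w ≤ x) = 1 - (x / w₀) ^ (1 - β)` for `x ≥ w₀`, and positions are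
uniform on the torus. -/
def girgMeasure (n : ℕ) (β w₀ : ℝ) (d : ℕ) : Measure (GIRGSample n d) :=
  Measure.pi fun _ => (paretoMeasure w₀ (β - 1)).prod (volume : Measure (Torus d))

/-- The connection threshold `(1/2) (lam * wu * wv / n) ^ (1/d)`. -/
def connThreshold (n d : ℕ) (lam wu wv : ℝ) : ℝ :=
  1 / 2 * (lam * wu * wv / (n : ℝ)) ^ (1 / (d : ℝ))

/-- The standard GIRG on given vertex data: distinct vertices are adjacent iff their distance on
the torus is at most their connection threshold. -/
def girgGraph {n d : ℕ} (lam : ℝ) (ω : GIRGSample n d) : SimpleGraph (Fin n) where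
  Adj u v := u ≠ v ∧ dist (ω u).2 (ω v).2 ≤ connThreshold n d lam (ω u).1 (ω v).1
  symm := ⟨fun u v h => ⟨h.1.symm, by
    have h2 := h.2
    rw [dist_comm]
    simpa only [connThreshold, mul_right_comm] using h2⟩⟩
  loopless := ⟨fun _ h => h.1 rfl⟩

/-- `K_k`, the number of `k`-cliques of the graph. -/
def numCliques {n d : ℕ} (lam : ℝ) (k : ℕ) (ω : GIRGSample n d) : ℕ :=
  ((girgGraph lam ω).cliqueSet k).ncard

/-- `E[K_k]`, the expected number of `k`-cliques in `GIRG(n, β, w₀, d)`. -/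
def expectedCliques (n : ℕ) (β w₀ lam : ℝ) (d k : ℕ) : ℝ :=
  ∫ ω, (numCliques lam k ω : ℝ) ∂(girgMeasure n β w₀ d)

end

/-!
By linearity and exchangeability, `E[K_k]` is `n.choose k` times the probability `cliqueProb` that
`k` independent vertices are pairwise adjacent, so everything rests on bounds for this probability.

*Upper bounds.* Every clique consists of a vertex `z` of minimal weight `w` and a clique among those
neighbours of `z` that are at least as heavy. Given `z`, a vertex is such a neighbour with
probability at most `K * w ^ (3 - β) / n`, and at most `(w / w₀) ^ (1 - β)`. If the remaining `k - 1`
vertices are grouped into disjoint pairs, the pairs are independent given `z`; this is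
`measure_cliqueTuples_le_pairs`. For `w` below `√(n / (lam * 2 ^ d))`, the two members of a
pair are in addition adjacent only with a probability that is exponentially small in `d`
(`measure_pair_le`): either one of them is heavier than `z` by a factor `(11 / 10) ^ d`, which is
unlikely under the Pareto law, or all three connection thresholds are comparable, and then in each
of the `d` coordinates the two points have a definite chance of lying on opposite sides of `z` and
too far apart (`volume_circle_pair_le`). Since there are at least `k / 6` pairs, this gives the
factor `exp (-a * d * k)`.

Integrating over `w` leaves an integral of `w ^ ((3 - β) * k - 3)`. If `(3 - β) * k > 2`, it is
dominated by weights of order `√n`, and the result is `n ^ (k / 2 * (3 - β))`. If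
`(3 - β) * k < 2`, it is dominated by weights of constant order, and the result is the
main term `n * exp (-Θ(1) * d * k) * Θ(k) ^ (-k)` plus a contribution of weights of order
`√(n / 2 ^ d)` and more. That contribution is below the main term if `d * k = o(log n)`, and tends
to zero if `β > 3`.

*Lower bounds.* Vertices of weight at least `√(n / lam)` are pairwise adjacent, and so are vertices
whose positions are within half of the minimal connection threshold of one of them. In both
directions the factor `Θ(k) ^ (-k)` comes from the binomial coefficient, which is at
most `(exp 1 * n / k) ^ k`, and at least `(n / k) ^ k` for `k ≤ n`.
-/

open scoped ENNReal

/-! ### Cliques among independent samples -/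

section Sampling

variable {X : Type*} [MeasurableSpace X] (μ : Measure X) [IsProbabilityMeasure μ]

/-- The coordinates of an i.i.d. sample along an injection form an i.i.d. sample. -/
theorem measurePreserving_pi_precomp {m n : ℕ} {e : Fin m → Fin n} (he : Function.Injective e) :
    MeasurePreserving (fun ω : Fin n → X => fun i => ω (e i))
      (Measure.pi fun _ => μ) (Measure.pi fun _ => μ) := by
  refine ⟨by fun_prop, ?_⟩
  have h := (iIndepFun_pi (μ := fun _ : Fin n => μ) (X := fun _ x => x)
    (fun _ => aemeasurable_id)).precomp he
  rw [iIndepFun_iff_map_fun_eq_pi_map fun i => (measurable_pi_apply (e i)).aemeasurable] at h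
  rw [h]
  congr 1
  funext i
  exact (measurePreserving_eval (fun _ : Fin n => μ) (e i)).map_eq

/-- Tuples of points of `N` that are pairwise related by `R`. -/
def cliqueTuples (R : X → X → Prop) (N : Set X) (m : ℕ) : Set (Fin m → X) :=
  {y | (∀ i, y i ∈ N) ∧ Pairwise fun i j => R (y i) (y j)}

variable {μ} {R : X → X → Prop}

theorem measurableSet_cliqueTuples (hR : MeasurableSet {p : X × X | R p.1 p.2}) {N : Set X}
    (hN : MeasurableSet N) (m : ℕ) : MeasurableSet (cliqueTuples R N m) := by
  have : cliqueTuples R N m = (⋂ i, {y | y i ∈ N}) ∩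
      ⋂ i, ⋂ j, ⋂ _ : i ≠ j, (fun y : Fin m → X => (y i, y j)) ⁻¹' {p | R p.1 p.2} := by
    ext y
    simp [cliqueTuples, Pairwise]
  rw [this]
  refine (MeasurableSet.iInter fun i => measurable_pi_apply i hN).inter
    (MeasurableSet.iInter fun i => .iInter fun j => .iInter fun _ => ?_)
  exact hR.preimage (by fun_prop)

theorem measure_cliqueTuples_succ_le (N : Set X) (m : ℕ) :
    Measure.pi (fun _ => μ) (cliqueTuples R N (m + 1)) ≤
      μ N * Measure.pi (fun _ => μ) (cliqueTuples R N m) := by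
  rw [← Measure.prod_prod, ← (measurePreserving_piFinSuccAbove (fun _ => μ)
    (0 : Fin (m + 1))).measure_preimage_equiv]
  refine measure_mono fun y hy => ⟨hy.1 0, fun i => hy.1 _, fun i j hij => hy.2 ?_⟩
  exact (Fin.succAbove_right_injective).ne hij

/-- The first two points of a clique form an adjacent pair independent of the remaining ones. -/
theorem measure_cliqueTuples_add_two_le (N : Set X) (m : ℕ) :
    Measure.pi (fun _ => μ) (cliqueTuples R N (m + 2)) ≤
      μ.prod μ {p | p.1 ∈ N ∧ p.2 ∈ N ∧ R p.1 p.2} *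
        Measure.pi (fun _ => μ) (cliqueTuples R N m) := by
  let e := ((MeasurableEquiv.piFinSuccAbove (fun _ => X) (0 : Fin (m + 2))).trans
    ((MeasurableEquiv.refl X).prodCongr
      (MeasurableEquiv.piFinSuccAbove (fun _ => X) (0 : Fin (m + 1))))).trans
    MeasurableEquiv.prodAssoc.symm
  have he : MeasurePreserving e (Measure.pi fun _ => μ)
      ((μ.prod μ).prod (Measure.pi fun _ => μ)) := by
    have h1 := measurePreserving_piFinSuccAbove (fun _ : Fin (m + 2) => μ) 0
    have h2 := (MeasurePreserving.id μ).prod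
      (measurePreserving_piFinSuccAbove (fun _ : Fin (m + 1) => μ) 0)
    have h3 := (measurePreserving_prodAssoc μ μ (Measure.pi fun _ : Fin m => μ)).symm
    exact (h3.comp h2).comp h1
  rw [← Measure.prod_prod, ← he.measure_preimage_equiv]
  refine measure_mono fun y hy => ⟨⟨hy.1 0, hy.1 _, hy.2 ?_⟩, fun i => hy.1 _, fun i j hij => hy.2 ?_⟩
  · exact (Fin.succAbove_ne 0 0).symm
  · exact Fin.succAbove_right_injective.ne (Fin.succAbove_right_injective.ne hij)

theorem measure_cliqueTuples_le_pow (N : Set X) (m : ℕ) :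
    Measure.pi (fun _ => μ) (cliqueTuples R N m) ≤ μ N ^ m := by
  induction m with
  | zero => simpa using prob_le_one
  | succ m ih =>
    rw [pow_succ']
    exact (measure_cliqueTuples_succ_le N m).trans (by gcongr)

/-- Splitting the points of a clique into disjoint pairs, with one point left over if their number
is odd. -/
theorem measure_cliqueTuples_le_pairs (N : Set X) (m : ℕ) :
    Measure.pi (fun _ => μ) (cliqueTuples R N m) ≤
      μ.prod μ {p | p.1 ∈ N ∧ p.2 ∈ N ∧ R p.1 p.2} ^ (m / 2) * μ N ^ (m % 2) := by
  induction m using Nat.twoStepInduction with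
  | zero => simpa using prob_le_one
  | one => simpa using measure_cliqueTuples_le_pow (μ := μ) (R := R) N 1
  | more m ih _ =>
    have h1 : (m + 2) / 2 = m / 2 + 1 := by omega
    have h2 : (m + 2) % 2 = m % 2 := by omega
    rw [h1, h2, pow_succ', mul_assoc]
    exact (measure_cliqueTuples_add_two_le N m).trans (by gcongr)

/-- A clique is a vertex of minimal weight together with a clique among those of its neighbours
that are at least as heavy. -/
theorem measure_cliqueTuples_univ_le (hR : MeasurableSet {p : X × X | R p.1 p.2}) {W : X → ℝ}
    (hW : Measurable W) (m : ℕ) :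
    Measure.pi (fun _ => μ) (cliqueTuples R Set.univ (m + 1)) ≤
      (m + 1 : ℕ) * ∫⁻ z, Measure.pi (fun _ => μ) (cliqueTuples R {y | W z ≤ W y ∧ R z y} m) ∂μ := by
  set D : Set (X × (Fin m → X)) := {p | p.2 ∈ cliqueTuples R {y | W p.1 ≤ W y ∧ R p.1 y} m} with hD
  have hDm : MeasurableSet D := by
    have : D = (⋂ i, {p | W p.1 ≤ W (p.2 i)} ∩ (fun p => (p.1, p.2 i)) ⁻¹' {p | R p.1 p.2}) ∩
        (fun p => p.2) ⁻¹' cliqueTuples R Set.univ m := by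
      ext p
      simp [hD, cliqueTuples]
    rw [this]
    refine (MeasurableSet.iInter fun i => (measurableSet_le (by fun_prop) ?_).inter
      (hR.preimage (by fun_prop))).inter
      (measurable_snd (measurableSet_cliqueTuples hR .univ m))
    exact hW.comp (by fun_prop)
  have key : ∀ v : Fin (m + 1),
      Measure.pi (fun _ => μ) ((MeasurableEquiv.piFinSuccAbove (fun _ => X) v) ⁻¹' D) =
        ∫⁻ z, Measure.pi (fun _ => μ) (cliqueTuples R {y | W z ≤ W y ∧ R z y} m) ∂μ := by
    intro v
    rw [(measurePreserving_piFinSuccAbove (fun _ => μ) v).measure_preimage_equiv,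
      Measure.prod_apply hDm]
    rfl
  have hsub : cliqueTuples R Set.univ (m + 1) ⊆
      ⋃ v, (MeasurableEquiv.piFinSuccAbove (fun _ => X) v) ⁻¹' D := by
    intro y hy
    obtain ⟨v, hv⟩ := Finite.exists_min fun i => W (y i)
    refine Set.mem_iUnion.2 ⟨v, fun i => ⟨hv _, hy.2 (Fin.succAbove_ne v i).symm⟩, fun i j hij => ?_⟩
    exact hy.2 (Fin.succAbove_right_injective.ne hij)
  calc _ ≤ _ := measure_mono hsub
    _ ≤ ∑ v, Measure.pi (fun _ => μ) ((MeasurableEquiv.piFinSuccAbove (fun _ => X) v) ⁻¹' D) :=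
      measure_iUnion_fintype_le _ _
    _ = _ := by
      rw [Finset.sum_congr rfl fun v _ => key v]
      simp

end Sampling

instance : IsProbabilityMeasure (volume : Measure UnitAddCircle) :=
  ⟨by simp⟩

/-! ### The expected number of cliques as a clique probability -/

/-- The law of the weight and the position of a single vertex. -/
noncomputable def vertexMeasure (β w₀ : ℝ) (d : ℕ) : Measure (ℝ × Torus d) :=
  (paretoMeasure w₀ (β - 1)).prod volume

/-- Adjacency of two vertices given by their weights and positions. -/
def girgRel (n d : ℕ) (lam : ℝ) (x y : ℝ × Torus d) : Prop :=
  dist x.2 y.2 ≤ connThreshold n d lam x.1 y.1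

/-- The probability that `k` independent vertices are pairwise adjacent. -/
noncomputable def cliqueProb (n : ℕ) (β w₀ lam : ℝ) (d k : ℕ) : ℝ≥0∞ :=
  Measure.pi (fun _ : Fin k => vertexMeasure β w₀ d) (cliqueTuples (girgRel n d lam) Set.univ k)

theorem isProbabilityMeasure_vertexMeasure {β w₀ : ℝ} (hβ : 2 < β) (hw₀ : 0 < w₀) (d : ℕ) :
    IsProbabilityMeasure (vertexMeasure β w₀ d) := by
  have := isProbabilityMeasure_paretoMeasure hw₀ (show 0 < β - 1 by linarith)
  unfold vertexMeasure
  infer_instance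

theorem measurableSet_girgRel (n d : ℕ) (lam : ℝ) :
    MeasurableSet {p : (ℝ × Torus d) × (ℝ × Torus d) | girgRel n d lam p.1 p.2} := by
  unfold girgRel connThreshold
  exact measurableSet_le (by fun_prop) (by fun_prop)

/-- Every set of `k` vertices is a clique with the same probability. -/
theorem expectedCliques_eq {β w₀ : ℝ} (hβ : 2 < β) (hw₀ : 0 < w₀) (n : ℕ) (lam : ℝ) (d k : ℕ) :
    expectedCliques n β w₀ lam d k = n.choose k * (cliqueProb n β w₀ lam d k).toReal := by
  classical
  have := isProbabilityMeasure_vertexMeasure hβ hw₀ d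
  set ν : Measure (GIRGSample n d) := girgMeasure n β w₀ d with hν
  have hν' : ν = Measure.pi fun _ => vertexMeasure β w₀ d := rfl
  have : IsProbabilityMeasure ν := by rw [hν']; infer_instance
  let C : Finset (Fin n) → Set (GIRGSample n d) := fun s => {ω | (girgGraph lam ω).IsClique s}
  have hpre : ∀ s ∈ Finset.powersetCard k (Finset.univ : Finset (Fin n)),
      ∃ e : Fin k → Fin n, Function.Injective e ∧
        C s = (fun ω i => ω (e i)) ⁻¹' cliqueTuples (girgRel n d lam) Set.univ k := by
    intro s hs
    have hk : s.card = k := (Finset.mem_powersetCard.1 hs).2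
    refine ⟨s.orderEmbOfFin hk, (s.orderEmbOfFin hk).injective, ?_⟩
    ext ω
    have hr : ∀ a, a ∈ s ↔ ∃ i, s.orderEmbOfFin hk i = a := fun a => by
      rw [← Set.mem_range, Finset.range_orderEmbOfFin, Finset.mem_coe]
    constructor
    · intro h
      refine ⟨fun _ => trivial, fun i j hij => ?_⟩
      exact (h ((hr _).2 ⟨i, rfl⟩) ((hr _).2 ⟨j, rfl⟩) ((s.orderEmbOfFin hk).injective.ne hij)).2
    · rintro ⟨-, h⟩ a ha b hb hab
      obtain ⟨i, rfl⟩ := (hr a).1 ha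
      obtain ⟨j, rfl⟩ := (hr b).1 hb
      exact ⟨hab, h fun hij => hab (by rw [hij])⟩
  have hm := measurableSet_cliqueTuples (measurableSet_girgRel n d lam) .univ k
  have hCm : ∀ s ∈ Finset.powersetCard k (Finset.univ : Finset (Fin n)), MeasurableSet (C s) := by
    intro s hs
    obtain ⟨e, -, h⟩ := hpre s hs
    rw [h]
    exact hm.preimage (by fun_prop)
  have hCν : ∀ s ∈ Finset.powersetCard k (Finset.univ : Finset (Fin n)),
      ν.real (C s) = (cliqueProb n β w₀ lam d k).toReal := by
    intro s hs
    obtain ⟨e, he, h⟩ := hpre s hs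
    rw [h, Measure.real, hν', (measurePreserving_pi_precomp _ he).measure_preimage
      hm.nullMeasurableSet]
    rfl
  have hnum : ∀ ω : GIRGSample n d, (numCliques lam k ω : ℝ) =
      ∑ s ∈ Finset.powersetCard k (Finset.univ : Finset (Fin n)), (C s).indicator 1 ω := by
    intro ω
    have : (girgGraph lam ω).cliqueSet k =
        ((Finset.powersetCard k (Finset.univ : Finset (Fin n))).filter fun s => ω ∈ C s :
          Finset (Finset (Fin n))) := by
      ext s
      simp only [SimpleGraph.mem_cliqueSet_iff, SimpleGraph.isNClique_iff, Finset.coe_filter,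
        Finset.mem_powersetCard, Finset.subset_univ, true_and, Set.mem_ofPred_eq, C]
      tauto
    rw [numCliques, this, Set.ncard_coe_finset, Finset.card_filter]
    push_cast
    refine Finset.sum_congr rfl fun s _ => ?_
    simp [Set.indicator_apply]
  unfold expectedCliques
  simp only [hnum]
  rw [integral_finsetSum]
  · rw [Finset.sum_congr rfl fun s hs => (integral_indicator_one (hCm s hs)).trans (hCν s hs)]
    simp
  · intro s hs
    exact (integrable_const (1 : ℝ)).indicator (hCm s hs)

/-! ### Geometry of the torus -/

theorem volume_torus_closedBall {d : ℕ} (x : Torus d) {r : ℝ} (hr : 0 ≤ r) :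
    volume (Metric.closedBall x r) = ENNReal.ofReal (min 1 (2 * r)) ^ d := by
  rw [closedBall_pi x hr, volume_pi_pi]
  simp [AddCircle.volume_closedBall]

/-- On the circle, two points of a short arc around `c` have a definite chance of lying on opposite
sides of `c` and hence being far from each other. -/
theorem volume_circle_pair_le (c : UnitAddCircle) {s₀ s t u : ℝ} (h₀ : 0 < s₀) (h₀' : s₀ ≤ 1 / 4)
    (hs : s₀ ≤ s) (hs' : s ≤ 11 / 10 * s₀) (ht : s₀ ≤ t) (ht' : t ≤ 11 / 10 * s₀)
    (hu : u < 5 / 4 * s₀) :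
    (volume : Measure (UnitAddCircle × UnitAddCircle))
      {p | dist c p.1 ≤ s ∧ dist c p.2 ≤ t ∧ dist p.1 p.2 ≤ u} ≤
        ENNReal.ofReal (98 / 100 * (2 * s * (2 * t))) := by
  set δ : UnitAddCircle := ((13 / 16 * s₀ : ℝ) : UnitAddCircle) with hδ
  -- two arcs on opposite sides of `c`, at distance `5 / 4 * s₀` from each other
  set A₁ := Metric.closedBall (c + δ) (3 / 16 * s₀)
  set A₂ := Metric.closedBall (c - δ) (3 / 16 * s₀)
  have hδn : ‖δ‖ = 13 / 16 * s₀ := by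
    rw [hδ, (AddCircle.norm_coe_eq_abs_iff 1 one_ne_zero).2, abs_of_pos (by positivity)]
    rw [abs_of_pos (by positivity), abs_one]
    linarith
  have hδn2 : ‖δ + δ‖ = 13 / 8 * s₀ := by
    have : δ + δ = ((13 / 8 * s₀ : ℝ) : UnitAddCircle) := by
      rw [hδ, ← AddCircle.coe_add]
      congr 1
      ring
    rw [this, (AddCircle.norm_coe_eq_abs_iff 1 one_ne_zero).2, abs_of_pos (by positivity)]
    rw [abs_of_pos (by positivity), abs_one]
    linarith
  have hA₁ : A₁ ⊆ Metric.closedBall c s := by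
    refine Metric.closedBall_subset_closedBall' ?_
    rw [dist_eq_norm, add_sub_cancel_left, hδn]
    linarith
  have hA₂ : A₂ ⊆ Metric.closedBall c t := by
    refine Metric.closedBall_subset_closedBall' ?_
    rw [dist_eq_norm, sub_sub_cancel_left, norm_neg, hδn]
    linarith
  have hsub : {p : UnitAddCircle × UnitAddCircle |
      dist c p.1 ≤ s ∧ dist c p.2 ≤ t ∧ dist p.1 p.2 ≤ u} ⊆
      (Metric.closedBall c s ×ˢ Metric.closedBall c t) \ (A₁ ×ˢ A₂) := by
    rintro ⟨x, y⟩ ⟨hx, hy, hxy⟩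
    refine ⟨⟨by simpa [dist_comm] using hx, by simpa [dist_comm] using hy⟩, ?_⟩
    rintro ⟨h1, h2⟩
    have h1 : dist x (c + δ) ≤ 3 / 16 * s₀ := h1
    have h2 : dist y (c - δ) ≤ 3 / 16 * s₀ := h2
    simp only at hxy
    have h3 : dist (c + δ) (c - δ) = 13 / 8 * s₀ := by
      rw [dist_eq_norm, add_sub_sub_cancel, hδn2]
    have h4 := dist_triangle4 (c + δ) x y (c - δ)
    rw [dist_comm (c + δ) x] at h4
    linarith
  refine (measure_mono hsub).trans ?_
  rw [measure_sdiff (Set.prod_mono hA₁ hA₂)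
    (Metric.isClosed_closedBall.measurableSet.prod
      Metric.isClosed_closedBall.measurableSet).nullMeasurableSet (measure_ne_top _ _)]
  rw [Measure.volume_eq_prod, Measure.prod_prod, Measure.prod_prod]
  simp only [A₁, A₂, AddCircle.volume_closedBall]
  rw [min_eq_right (by linarith), min_eq_right (by linarith), min_eq_right (by linarith),
    ← ENNReal.ofReal_mul (by linarith), ← ENNReal.ofReal_mul (by linarith),
    ← ENNReal.ofReal_sub _ (by positivity)]
  refine ENNReal.ofReal_le_ofReal ?_
  have : s * t ≤ 11 / 10 * s₀ * (11 / 10 * s₀) := mul_le_mul hs' ht' (by linarith) (by linarith)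
  nlinarith

/-- The gain on the circle holds in each coordinate, hence is exponential in the dimension. -/
theorem volume_torus_pair_le {d : ℕ} (c : Torus d) {s₀ s t u : ℝ} (h₀ : 0 < s₀) (h₀' : s₀ ≤ 1 / 4)
    (hs : s₀ ≤ s) (hs' : s ≤ 11 / 10 * s₀) (ht : s₀ ≤ t) (ht' : t ≤ 11 / 10 * s₀)
    (hu : u < 5 / 4 * s₀) :
    (volume : Measure (Torus d × Torus d))
      {p | dist c p.1 ≤ s ∧ dist c p.2 ≤ t ∧ dist p.1 p.2 ≤ u} ≤
        ENNReal.ofReal (98 / 100 * (2 * s * (2 * t))) ^ d := by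
  rw [← (volume_measurePreserving_arrowProdEquivProdArrow UnitAddCircle UnitAddCircle
    (Fin d)).measure_preimage_equiv]
  calc _ ≤ (volume : Measure (Fin d → UnitAddCircle × UnitAddCircle))
        (Set.univ.pi fun i => {p | dist (c i) p.1 ≤ s ∧ dist (c i) p.2 ≤ t ∧ dist p.1 p.2 ≤ u}) := by
        refine measure_mono ?_
        rintro p ⟨h1, h2, h3⟩ i -
        exact ⟨(dist_le_pi_dist _ _ i).trans h1, (dist_le_pi_dist _ _ i).trans h2,
          (dist_le_pi_dist _ _ i).trans h3⟩
    _ = ∏ i, volume {p : UnitAddCircle × UnitAddCircle |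
          dist (c i) p.1 ≤ s ∧ dist (c i) p.2 ≤ t ∧ dist p.1 p.2 ≤ u} := volume_pi_pi _
    _ ≤ ∏ _i : Fin d, ENNReal.ofReal (98 / 100 * (2 * s * (2 * t))) :=
        Finset.prod_le_prod' fun i _ => volume_circle_pair_le (c i) h₀ h₀' hs hs' ht ht' hu
    _ = _ := by simp

/-! ### Truncated moments of the Pareto distribution -/

theorem ae_le_paretoMeasure {t r : ℝ} : ∀ᵐ x ∂paretoMeasure t r, t ≤ x := by
  have : paretoMeasure t r (Set.Iio t) = 0 := by
    rw [paretoMeasure, withDensity_apply _ measurableSet_Iio, lintegral_paretoPDF_of_le le_rfl]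
  filter_upwards [measure_eq_zero_iff_ae_notMem.1 this] with x hx
  simpa using hx

theorem setLIntegral_rpow_paretoMeasure {w₀ α s : ℝ} (hw₀ : 0 < w₀) (hα : 0 < α) {S : Set ℝ}
    (hS : MeasurableSet S) (hS' : S ⊆ Set.Ici w₀) :
    ∫⁻ x in S, ENNReal.ofReal (x ^ s) ∂paretoMeasure w₀ α =
      ∫⁻ x in S, ENNReal.ofReal (α * w₀ ^ α * x ^ (s - α - 1)) := by
  have hm : Measurable (paretoPDF w₀ α) := (measurable_paretoPDFReal w₀ α).ennreal_ofReal
  rw [paretoMeasure, setLIntegral_withDensity_eq_setLIntegral_mul _ hm (by fun_prop) hS]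
  refine setLIntegral_congr_fun hS fun x hx => ?_
  have hx' : w₀ ≤ x := hS' hx
  have hx0 : 0 < x := hw₀.trans_le hx'
  rw [Pi.mul_apply, paretoPDF_of_le hx', ← ENNReal.ofReal_mul (by positivity), mul_assoc,
    ← Real.rpow_add hx0]
  congr 3
  ring

theorem setLIntegral_Ici_rpow_paretoMeasure {w₀ α s w : ℝ} (hw₀ : 0 < w₀) (hα : 0 < α)
    (hw : w₀ ≤ w) (hs : s < α) :
    ∫⁻ x in Set.Ici w, ENNReal.ofReal (x ^ s) ∂paretoMeasure w₀ α =
      ENNReal.ofReal (α * w₀ ^ α / (α - s) * w ^ (s - α)) := by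
  have hw' : 0 < w := hw₀.trans_le hw
  rw [setLIntegral_rpow_paretoMeasure hw₀ hα measurableSet_Ici (Set.Ici_subset_Ici.2 hw),
    setLIntegral_congr Ioi_ae_eq_Ici.symm, ← ofReal_integral_eq_lintegral_ofReal,
    integral_const_mul, integral_Ioi_rpow_of_lt (by linarith) hw']
  · congr 1
    have : α - s ≠ 0 := by linarith
    rw [show s - α - 1 + 1 = -(α - s) by ring, neg_div_neg_eq, show s - α = -(α - s) by ring]
    ring
  · exact (integrableOn_Ioi_rpow_of_lt (by linarith) hw').const_mul _
  · refine (ae_restrict_iff' measurableSet_Ioi).2 (ae_of_all _ fun x hx => ?_)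
    have : 0 < x := hw'.trans hx
    simp only [Pi.zero_apply]
    positivity

theorem setLIntegral_Iio_rpow_paretoMeasure_le {w₀ α s M : ℝ} (hw₀ : 0 < w₀) (hα : 0 < α)
    (hM : w₀ ≤ M) (hs : α < s) :
    ∫⁻ x in Set.Iio M, ENNReal.ofReal (x ^ s) ∂paretoMeasure w₀ α ≤
      ENNReal.ofReal (α * w₀ ^ α / (s - α) * M ^ (s - α)) := by
  have hM' : 0 < M := hw₀.trans_le hM
  have h1 : ∫⁻ x in Set.Iio M, ENNReal.ofReal (x ^ s) ∂paretoMeasure w₀ α =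
      ∫⁻ x in Set.Ico w₀ M, ENNReal.ofReal (x ^ s) ∂paretoMeasure w₀ α := by
    refine setLIntegral_congr ?_
    filter_upwards [ae_le_paretoMeasure] with x hx
    exact propext ⟨fun h => ⟨hx, h⟩, fun h => h.2⟩
  rw [h1, setLIntegral_rpow_paretoMeasure hw₀ hα measurableSet_Ico Set.Ico_subset_Ici_self,
    setLIntegral_congr Ico_ae_eq_Ioc, ← ofReal_integral_eq_lintegral_ofReal,
    integral_const_mul, ← intervalIntegral.integral_of_le hM, integral_rpow (.inl (by linarith))]
  · refine ENNReal.ofReal_le_ofReal ?_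
    rw [show s - α - 1 + 1 = s - α by ring, div_mul_eq_mul_div, mul_div_assoc]
    have : 0 < s - α := by linarith
    gcongr
    linarith [Real.rpow_nonneg hw₀.le (s - α)]
  · refine Integrable.const_mul ?_ _
    exact (intervalIntegrable_iff_integrableOn_Ioc_of_le hM).1
      (intervalIntegral.intervalIntegrable_rpow' (by linarith))
  · refine (ae_restrict_iff' measurableSet_Ioc).2 (ae_of_all _ fun x hx => ?_)
    have : 0 < x := hw₀.trans hx.1
    simp only [Pi.zero_apply]
    positivity

/-! ### Connection probabilities given the lightest vertex of a clique -/

section Connection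

variable {n d : ℕ} {lam : ℝ}

theorem connThreshold_nonneg {w w' : ℝ} (hlam : 0 ≤ lam) (hw : 0 ≤ w) (hw' : 0 ≤ w') :
    0 ≤ connThreshold n d lam w w' := by
  unfold connThreshold
  positivity

theorem two_mul_connThreshold_pow {w w' : ℝ} (hd : 1 ≤ d) (hlam : 0 ≤ lam) (hw : 0 ≤ w)
    (hw' : 0 ≤ w') : (2 * connThreshold n d lam w w') ^ d = lam * w * w' / n := by
  have : 2 * connThreshold n d lam w w' = (lam * w * w' / n) ^ ((d : ℝ)⁻¹) := by
    unfold connThreshold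
    rw [one_div (d : ℝ)]
    ring
  rw [this, Real.rpow_inv_natCast_pow (by positivity) (by omega)]

theorem connThreshold_le_mul {w w' z z' c : ℝ} (hd : 1 ≤ d) (hlam : 0 ≤ lam) (hw : 0 ≤ w)
    (hw' : 0 ≤ w') (hz : 0 ≤ z) (hz' : 0 ≤ z') (hc : 0 ≤ c) (h : w * w' ≤ c ^ d * (z * z')) :
    connThreshold n d lam w w' ≤ c * connThreshold n d lam z z' := by
  have h1 := connThreshold_nonneg (n := n) (d := d) hlam hz hz'
  have h2 := connThreshold_nonneg (n := n) (d := d) hlam hw hw'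
  have : 2 * connThreshold n d lam w w' ≤ c * (2 * connThreshold n d lam z z') := by
    rw [← pow_le_pow_iff_left₀ (by positivity) (by positivity) (show d ≠ 0 by omega), mul_pow c,
      two_mul_connThreshold_pow hd hlam hw hw', two_mul_connThreshold_pow hd hlam hz hz',
      ← mul_div_assoc]
    refine div_le_div_of_nonneg_right ?_ n.cast_nonneg
    calc lam * w * w' = lam * (w * w') := by ring
      _ ≤ lam * (c ^ d * (z * z')) := by gcongr
      _ = _ := by ring
  linarith

theorem volume_dist_le_connThreshold_le {w w' : ℝ} (hd : 1 ≤ d) (hlam : 0 ≤ lam) (hw : 0 ≤ w)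
    (hw' : 0 ≤ w') (x : Torus d) :
    volume {x' | dist x x' ≤ connThreshold n d lam w w'} ≤ ENNReal.ofReal (lam * w * w' / n) := by
  have h1 := connThreshold_nonneg (n := n) (d := d) hlam hw hw'
  have : {x' | dist x x' ≤ connThreshold n d lam w w'} =
      Metric.closedBall x (connThreshold n d lam w w') := by
    ext
    simp [dist_comm]
  rw [this, volume_torus_closedBall _ h1, ← two_mul_connThreshold_pow hd hlam hw hw',
    ENNReal.ofReal_pow (by positivity)]
  gcongr
  exact min_le_right _ _

/-- The constant in the bound `K * w ^ (3 - β) / n` on the probability that a vertex of weight `w`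
is adjacent to a given vertex that is at least as heavy. -/
noncomputable def nbrConst (β w₀ lam : ℝ) : ℝ := lam * (β - 1) * w₀ ^ (β - 1) / (β - 2)

theorem nbrConst_pos {β w₀ : ℝ} (hβ : 2 < β) (hw₀ : 0 < w₀) (hlam : 0 < lam) :
    0 < nbrConst β w₀ lam := by
  have h1 : 0 < β - 1 := by linarith
  have h2 : 0 < β - 2 := by linarith
  unfold nbrConst
  positivity

variable {β w₀ : ℝ}

theorem setLIntegral_connection (hβ : 2 < β) (hw₀ : 0 < w₀) (hlam : 0 < lam) {z h : ℝ}
    (hz : w₀ ≤ z) (hh : w₀ ≤ h) :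
    ∫⁻ w in Set.Ici h, ENNReal.ofReal (lam * z * w / n) ∂paretoMeasure w₀ (β - 1) =
      ENNReal.ofReal (nbrConst β w₀ lam * z * h ^ (2 - β) / n) := by
  have hz' : 0 < z := hw₀.trans_le hz
  have : ∀ w : ℝ, ENNReal.ofReal (lam * z * w / n) =
      ENNReal.ofReal (lam * z / n) * ENNReal.ofReal (w ^ (1 : ℝ)) := by
    intro w
    rw [← ENNReal.ofReal_mul (by positivity), Real.rpow_one]
    congr 1
    ring
  simp only [this]
  rw [lintegral_const_mul _ (by fun_prop),
    setLIntegral_Ici_rpow_paretoMeasure hw₀ (by linarith) hh (by linarith),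
    ← ENNReal.ofReal_mul (by positivity)]
  congr 1
  rw [nbrConst, show 1 - (β - 1) = 2 - β by ring, show β - 1 - 1 = β - 2 by ring]
  ring

theorem measurableSet_nbr (z : ℝ × Torus d) (h : ℝ) :
    MeasurableSet {y : ℝ × Torus d | h ≤ y.1 ∧ girgRel n d lam z y} := by
  have h1 : MeasurableSet {y : ℝ × Torus d | h ≤ y.1} :=
    measurableSet_le measurable_const measurable_fst
  have h2 : MeasurableSet {y : ℝ × Torus d | girgRel n d lam z y} := by
    unfold girgRel connThreshold
    exact measurableSet_le (by fun_prop) (by fun_prop)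
  exact h1.inter h2

theorem vertexMeasure_nbr_le (hβ : 2 < β) (hw₀ : 0 < w₀) (hlam : 0 < lam) (hd : 1 ≤ d)
    {z : ℝ × Torus d} {h : ℝ} (hz : w₀ ≤ z.1) (hh : w₀ ≤ h) :
    vertexMeasure β w₀ d {y | h ≤ y.1 ∧ girgRel n d lam z y} ≤
      ENNReal.ofReal (nbrConst β w₀ lam * z.1 * h ^ (2 - β) / n) := by
  have := isProbabilityMeasure_paretoMeasure hw₀ (show 0 < β - 1 by linarith)
  rw [vertexMeasure, Measure.prod_apply (measurableSet_nbr z h),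
    ← setLIntegral_connection hβ hw₀ hlam hz hh, ← lintegral_indicator measurableSet_Ici]
  refine lintegral_mono fun w => ?_
  by_cases hw : h ≤ w
  · rw [Set.indicator_of_mem (show w ∈ Set.Ici h from hw)]
    have hz' : 0 ≤ z.1 := (hw₀.trans_le hz).le
    have hw' : 0 ≤ w := (hw₀.trans_le (hh.trans hw)).le
    refine (measure_mono fun x hx => ?_).trans
      (volume_dist_le_connThreshold_le hd hlam.le hz' hw' z.2)
    exact hx.2
  · have : Prod.mk w ⁻¹' {y : ℝ × Torus d | h ≤ y.1 ∧ girgRel n d lam z y} = ∅ := by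
      ext x
      simp [hw]
    simp [this]

theorem vertexMeasure_weight_ge (hβ : 2 < β) (hw₀ : 0 < w₀) {h : ℝ} (hh : w₀ ≤ h) :
    vertexMeasure β w₀ d {y | h ≤ y.1} = ENNReal.ofReal (w₀ ^ (β - 1) * h ^ (1 - β)) := by
  have := isProbabilityMeasure_paretoMeasure hw₀ (show 0 < β - 1 by linarith)
  have h1 := setLIntegral_Ici_rpow_paretoMeasure (s := 0) hw₀ (show 0 < β - 1 by linarith) hh
    (by linarith)
  simp only [Real.rpow_zero, ENNReal.ofReal_one, setLIntegral_one] at h1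
  have h2 : {y : ℝ × Torus d | h ≤ y.1} = Set.Ici h ×ˢ Set.univ := by
    ext
    simp
  rw [h2, vertexMeasure, Measure.prod_prod, h1, measure_univ, mul_one]
  congr 1
  have : β - 1 ≠ 0 := by linarith
  rw [sub_zero, zero_sub, neg_sub]
  field_simp

end Connection

/-! ### The gain from adjacency of two neighbours -/

theorem measurePreserving_prod_prod_prod_comm {A B C D : Type*} [MeasurableSpace A]
    [MeasurableSpace B] [MeasurableSpace C] [MeasurableSpace D] (μ : Measure A) (ν : Measure B)
    (ρ : Measure C) (σ : Measure D) [SFinite μ] [SFinite ν] [SFinite ρ] [SFinite σ] :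
    MeasurePreserving (fun p : (A × B) × (C × D) => ((p.1.1, p.2.1), (p.1.2, p.2.2)))
      ((μ.prod ν).prod (ρ.prod σ)) ((μ.prod ρ).prod (ν.prod σ)) := by
  have h1 := measurePreserving_prodAssoc μ ν (ρ.prod σ)
  have h2 := (MeasurePreserving.id μ).prod (measurePreserving_prodAssoc ν ρ σ).symm
  have h3 := (MeasurePreserving.id μ).prod
    ((Measure.measurePreserving_swap (μ := ν) (ν := ρ)).prod (MeasurePreserving.id σ))
  have h4 := (MeasurePreserving.id μ).prod (measurePreserving_prodAssoc ρ ν σ)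
  have h5 := (measurePreserving_prodAssoc μ ρ (ν.prod σ)).symm
  exact h5.comp (h4.comp (h3.comp (h2.comp h1)))

/-- The factor gained in each dimension when two neighbours of a vertex have to be adjacent. -/
noncomputable def pairGain (β : ℝ) : ℝ := max (98 / 100) ((11 / 10) ^ (2 - β))

theorem pairGain_pos (β : ℝ) : 0 < pairGain β := lt_max_of_lt_left (by norm_num)

theorem pairGain_lt_one {β : ℝ} (hβ : 2 < β) : pairGain β < 1 :=
  max_lt (by norm_num) (Real.rpow_lt_one_of_one_lt_of_neg (by norm_num) (by linarith))

section Pair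

variable {n d : ℕ} {lam β w₀ : ℝ}

/-- If both weights are comparable to the weight of `z`, then the gain comes from the geometry. -/
theorem measure_light_pair_le (hβ : 2 < β) (hw₀ : 0 < w₀) (hlam : 0 < lam) (hd : 1 ≤ d)
    (hn : 1 ≤ n) {z : ℝ × Torus d} (hz : w₀ ≤ z.1) (hz' : lam * z.1 * z.1 / n ≤ (1 / 2) ^ d) :
    (vertexMeasure β w₀ d).prod (vertexMeasure β w₀ d)
      {p | (z.1 ≤ p.1.1 ∧ girgRel n d lam z p.1) ∧ (z.1 ≤ p.2.1 ∧ girgRel n d lam z p.2) ∧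
        girgRel n d lam p.1 p.2 ∧ p.1.1 < (11 / 10) ^ d * z.1 ∧ p.2.1 < (11 / 10) ^ d * z.1} ≤
      ENNReal.ofReal ((nbrConst β w₀ lam * z.1 ^ (3 - β) / n) ^ 2 * (98 / 100) ^ d) := by
  have := isProbabilityMeasure_paretoMeasure hw₀ (show 0 < β - 1 by linarith)
  have hz0 : 0 < z.1 := hw₀.trans_le hz
  have hn' : (0 : ℝ) < n := by exact_mod_cast hn
  set S := {p : (ℝ × Torus d) × (ℝ × Torus d) |
    (z.1 ≤ p.1.1 ∧ girgRel n d lam z p.1) ∧ (z.1 ≤ p.2.1 ∧ girgRel n d lam z p.2) ∧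
        girgRel n d lam p.1 p.2 ∧ p.1.1 < (11 / 10) ^ d * z.1 ∧ p.2.1 < (11 / 10) ^ d * z.1}
    with hS
  have hSm : MeasurableSet S := by
    refine ((measurableSet_nbr z z.1).preimage measurable_fst).inter
      (((measurableSet_nbr z z.1).preimage measurable_snd).inter
      ((measurableSet_girgRel n d lam).inter (MeasurableSet.inter
        (s₁ := {p : (ℝ × Torus d) × (ℝ × Torus d) | p.1.1 < (11 / 10) ^ d * z.1})
        (s₂ := {p : (ℝ × Torus d) × (ℝ × Torus d) | p.2.1 < (11 / 10) ^ d * z.1})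
        (measurableSet_lt ?_ ?_) (measurableSet_lt ?_ ?_)))) <;> fun_prop
  set g : ℝ → ℝ≥0∞ := (Set.Ici z.1).indicator fun w => ENNReal.ofReal (lam * z.1 * w / n) with hg
  have hgm : Measurable g := Measurable.indicator (by fun_prop) measurableSet_Ici
  have hgi : ∫⁻ w, g w ∂paretoMeasure w₀ (β - 1) =
      ENNReal.ofReal (nbrConst β w₀ lam * z.1 ^ (3 - β) / n) := by
    rw [hg, lintegral_indicator measurableSet_Ici, setLIntegral_connection hβ hw₀ hlam hz hz,
      show (3 - β) = 1 + (2 - β) by ring, Real.rpow_add hz0, Real.rpow_one, mul_assoc]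
  have hcs := measurePreserving_prod_prod_prod_comm (paretoMeasure w₀ (β - 1))
    (paretoMeasure w₀ (β - 1)) (volume : Measure (Torus d)) (volume : Measure (Torus d))
  rw [vertexMeasure, ← hcs.measure_preimage hSm.nullMeasurableSet,
    Measure.prod_apply (hcs.measurable hSm)]
  calc _ ≤ ∫⁻ p : ℝ × ℝ, ENNReal.ofReal ((98 / 100) ^ d) * (g p.1 * g p.2)
          ∂(paretoMeasure w₀ (β - 1)).prod (paretoMeasure w₀ (β - 1)) := by
        refine lintegral_mono fun p => ?_
        by_cases hp : (z.1 ≤ p.1 ∧ p.1 < (11 / 10) ^ d * z.1) ∧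
            (z.1 ≤ p.2 ∧ p.2 < (11 / 10) ^ d * z.1)
        swap
        · refine (measure_mono_null (t := ∅) ?_ measure_empty).trans_le zero_le
          rintro q ⟨⟨h1, -⟩, ⟨h2, -⟩, -, h3, h4⟩
          exact hp ⟨⟨h1, h3⟩, h2, h4⟩
        obtain ⟨⟨h1, h1'⟩, h2, h2'⟩ := hp
        have hp1 : 0 < p.1 := hz0.trans_le h1
        have hp2 : 0 < p.2 := hz0.trans_le h2
        set s₀ := connThreshold n d lam z.1 z.1 with hs₀
        have hs₀pow : (2 * s₀) ^ d = lam * z.1 * z.1 / n :=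
          two_mul_connThreshold_pow hd hlam.le hz0.le hz0.le
        have hs₀0 : 0 < s₀ := by
          rw [hs₀]
          unfold connThreshold
          positivity
        have hs₀4 : s₀ ≤ 1 / 4 := by
          rw [← hs₀pow, pow_le_pow_iff_left₀ (by positivity) (by norm_num) (by omega)] at hz'
          linarith
        have lower : ∀ w, z.1 ≤ w → s₀ ≤ connThreshold n d lam z.1 w := fun w hw => by
          have := connThreshold_le_mul (n := n) (c := 1) hd hlam.le hz0.le hz0.le hz0.le
            (hz0.le.trans hw) zero_le_one
            (by rw [one_pow, one_mul]; exact mul_le_mul_of_nonneg_left hw hz0.le)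
          rwa [one_mul] at this
        have upper : ∀ w, z.1 ≤ w → w < (11 / 10) ^ d * z.1 →
            connThreshold n d lam z.1 w ≤ 11 / 10 * s₀ := fun w hw hw' => by
          refine connThreshold_le_mul hd hlam.le hz0.le (hz0.le.trans hw) hz0.le hz0.le
            (by norm_num) ?_
          calc z.1 * w ≤ z.1 * ((11 / 10) ^ d * z.1) := by gcongr
            _ = _ := by ring
        have hu : connThreshold n d lam p.1 p.2 < 5 / 4 * s₀ := by
          refine (connThreshold_le_mul (z := z.1) (z' := z.1) (c := (11 / 10) ^ 2) hd hlam.le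
            hp1.le hp2.le hz0.le hz0.le (by norm_num) ?_).trans_lt ?_
          · calc p.1 * p.2 ≤ ((11 / 10) ^ d * z.1) * ((11 / 10) ^ d * z.1) := by gcongr
              _ = _ := by rw [← pow_mul, mul_comm 2 d, pow_mul]; ring
          · rw [← hs₀]
            nlinarith
        have h3 := volume_torus_pair_le z.2 hs₀0 hs₀4 (lower p.1 h1) (upper p.1 h1 h1')
          (lower p.2 h2) (upper p.2 h2 h2') hu
        refine (measure_mono ?_).trans (h3.trans_eq ?_)
        · rintro q ⟨⟨-, h4⟩, ⟨-, h5⟩, h6, -, -⟩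
          exact ⟨h4, h5, h6⟩
        · have t1 := connThreshold_nonneg (n := n) (d := d) hlam.le hz0.le hp1.le
          have t2 := connThreshold_nonneg (n := n) (d := d) hlam.le hz0.le hp2.le
          rw [hg, Set.indicator_of_mem (show p.1 ∈ Set.Ici z.1 from h1),
            Set.indicator_of_mem (show p.2 ∈ Set.Ici z.1 from h2),
            ← ENNReal.ofReal_mul (by positivity), ← ENNReal.ofReal_mul (by positivity),
            ← ENNReal.ofReal_pow (by positivity), mul_pow, mul_pow,
            two_mul_connThreshold_pow hd hlam.le hz0.le hp1.le,
            two_mul_connThreshold_pow hd hlam.le hz0.le hp2.le]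
    _ = _ := by
        rw [lintegral_const_mul _ (by fun_prop), lintegral_prod_mul hgm.aemeasurable
          hgm.aemeasurable, hgi, ← ENNReal.ofReal_mul, ← ENNReal.ofReal_mul (by positivity)]
        · congr 1
          ring
        · have := nbrConst_pos hβ hw₀ hlam
          positivity

/-- A vertex of small weight forms a triangle with two vertices that are at least as heavy with a
probability that is exponentially small in `d` compared to that of the two adjacencies. -/
theorem measure_pair_le (hβ : 2 < β) (hw₀ : 0 < w₀) (hlam : 0 < lam) (hd : 1 ≤ d)
    (hn : 1 ≤ n) {z : ℝ × Torus d} (hz : w₀ ≤ z.1) (hz' : lam * z.1 * z.1 / n ≤ (1 / 2) ^ d) :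
    (vertexMeasure β w₀ d).prod (vertexMeasure β w₀ d)
      {p | p.1 ∈ {y | z.1 ≤ y.1 ∧ girgRel n d lam z y} ∧
        p.2 ∈ {y | z.1 ≤ y.1 ∧ girgRel n d lam z y} ∧ girgRel n d lam p.1 p.2} ≤
      ENNReal.ofReal (3 * (nbrConst β w₀ lam * z.1 ^ (3 - β) / n) ^ 2 * pairGain β ^ d) := by
  have := isProbabilityMeasure_vertexMeasure hβ hw₀ d
  have hz0 : 0 < z.1 := hw₀.trans_le hz
  set ν := vertexMeasure β w₀ d
  set N := {y : ℝ × Torus d | z.1 ≤ y.1 ∧ girgRel n d lam z y} with hN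
  set H := {y : ℝ × Torus d | (11 / 10) ^ d * z.1 ≤ y.1 ∧ girgRel n d lam z y} with hH
  set q := nbrConst β w₀ lam * z.1 ^ (3 - β) / n with hq
  have hq0 : 0 ≤ q := by
    have := nbrConst_pos hβ hw₀ hlam
    positivity
  have hzz : z.1 ^ (3 - β) = z.1 * z.1 ^ (2 - β) := by
    rw [show (3 - β) = 1 + (2 - β) by ring, Real.rpow_add hz0, Real.rpow_one]
  have hNle : ν N ≤ ENNReal.ofReal q := by
    refine (vertexMeasure_nbr_le hβ hw₀ hlam hd hz hz).trans_eq ?_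
    rw [hq, hzz, mul_assoc]
  have hθ : (1 : ℝ) ≤ (11 / 10) ^ d := one_le_pow₀ (by norm_num)
  have hHle : ν H ≤ ENNReal.ofReal (q * pairGain β ^ d) := by
    refine (vertexMeasure_nbr_le hβ hw₀ hlam hd hz (hz.trans ?_)).trans ?_
    · exact le_mul_of_one_le_left hz0.le hθ
    · refine ENNReal.ofReal_le_ofReal ?_
      rw [Real.mul_rpow (by positivity) hz0.le, ← Real.rpow_natCast, ← Real.rpow_mul (by norm_num),
        mul_comm (d : ℝ), Real.rpow_mul (by norm_num), Real.rpow_natCast]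
      calc _ = q * ((11 / 10 : ℝ) ^ (2 - β)) ^ d := by rw [hq, hzz]; ring
        _ ≤ _ := by
          gcongr
          exact le_max_right _ _
  have hsub : {p : (ℝ × Torus d) × (ℝ × Torus d) | p.1 ∈ N ∧ p.2 ∈ N ∧ girgRel n d lam p.1 p.2} ⊆
      (H ×ˢ N ∪ N ×ˢ H) ∪ {p | (z.1 ≤ p.1.1 ∧ girgRel n d lam z p.1) ∧
        (z.1 ≤ p.2.1 ∧ girgRel n d lam z p.2) ∧
        girgRel n d lam p.1 p.2 ∧ p.1.1 < (11 / 10) ^ d * z.1 ∧ p.2.1 < (11 / 10) ^ d * z.1} := by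
    rintro p ⟨h1, h2, h3⟩
    by_cases h4 : (11 / 10) ^ d * z.1 ≤ p.1.1
    · exact .inl (.inl ⟨⟨h4, h1.2⟩, h2⟩)
    by_cases h5 : (11 / 10) ^ d * z.1 ≤ p.2.1
    · exact .inl (.inr ⟨h1, h5, h2.2⟩)
    exact .inr ⟨h1, h2, h3, not_le.1 h4, not_le.1 h5⟩
  refine (measure_mono hsub).trans ((measure_union_le _ _).trans
    ((add_le_add_left (measure_union_le _ _) _).trans ?_))
  rw [Measure.prod_prod, Measure.prod_prod]
  have hη := pairGain_pos β
  calc _ ≤ ENNReal.ofReal (q * pairGain β ^ d) * ENNReal.ofReal q +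
        ENNReal.ofReal q * ENNReal.ofReal (q * pairGain β ^ d) +
        ENNReal.ofReal (q ^ 2 * pairGain β ^ d) := by
        gcongr
        refine (measure_light_pair_le hβ hw₀ hlam hd hn hz hz').trans ?_
        refine ENNReal.ofReal_le_ofReal ?_
        gcongr
        exact le_max_left _ _
    _ = _ := by
        rw [← ENNReal.ofReal_mul (by positivity), ← ENNReal.ofReal_mul (by positivity),
          ← ENNReal.ofReal_add (by positivity) (by positivity),
          ← ENNReal.ofReal_add (by positivity) (by positivity)]
        congr 1
        ring

end Pair

/-! ### Bounds on the clique probability -/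

section CliqueProb

variable {n d : ℕ} {lam β w₀ : ℝ}

theorem ae_le_vertexMeasure (hβ : 2 < β) (hw₀ : 0 < w₀) (d : ℕ) :
    ∀ᵐ z ∂vertexMeasure β w₀ d, w₀ ≤ z.1 := by
  have := isProbabilityMeasure_paretoMeasure hw₀ (show 0 < β - 1 by linarith)
  have : MeasurePreserving Prod.fst (vertexMeasure β w₀ d) (paretoMeasure w₀ (β - 1)) :=
    measurePreserving_fst
  exact this.quasiMeasurePreserving.ae ae_le_paretoMeasure

/-- Integration over the lightest vertex of a clique, with power bounds on its weight that change
at the threshold `M`. -/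
theorem lintegral_vertexMeasure_le (hβ : 2 < β) (hw₀ : 0 < w₀) {Ψ : ℝ × Torus d → ℝ≥0∞}
    {M c c' s s' : ℝ}
    (h : ∀ z : ℝ × Torus d, w₀ ≤ z.1 → z.1 < M → Ψ z ≤ ENNReal.ofReal c * ENNReal.ofReal (z.1 ^ s))
    (h' : ∀ z : ℝ × Torus d, w₀ ≤ z.1 → M ≤ z.1 →
      Ψ z ≤ ENNReal.ofReal c' * ENNReal.ofReal (z.1 ^ s')) :
    ∫⁻ z, Ψ z ∂vertexMeasure β w₀ d ≤
      ENNReal.ofReal c * ∫⁻ w in Set.Iio M, ENNReal.ofReal (w ^ s) ∂paretoMeasure w₀ (β - 1) +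
      ENNReal.ofReal c' * ∫⁻ w in Set.Ici M, ENNReal.ofReal (w ^ s') ∂paretoMeasure w₀ (β - 1) := by
  have := isProbabilityMeasure_paretoMeasure hw₀ (show 0 < β - 1 by linarith)
  have hfst : MeasurePreserving Prod.fst (vertexMeasure β w₀ d) (paretoMeasure w₀ (β - 1)) :=
    measurePreserving_fst
  set f : ℝ → ℝ≥0∞ := (Set.Iio M).indicator fun w => ENNReal.ofReal c * ENNReal.ofReal (w ^ s)
  set f' : ℝ → ℝ≥0∞ := (Set.Ici M).indicator fun w => ENNReal.ofReal c' * ENNReal.ofReal (w ^ s')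
  have hf : Measurable f := Measurable.indicator (by fun_prop) measurableSet_Iio
  have hf' : Measurable f' := Measurable.indicator (by fun_prop) measurableSet_Ici
  calc _ ≤ ∫⁻ z : ℝ × Torus d, (f + f') z.1 ∂vertexMeasure β w₀ d := by
        refine lintegral_mono_ae ?_
        filter_upwards [ae_le_vertexMeasure hβ hw₀ d] with z hz
        rcases lt_or_ge z.1 M with hM | hM
        · refine (h z hz hM).trans (le_trans ?_ (le_self_add (b := f' z.1)))
          simp only [f, Set.indicator_of_mem (show z.1 ∈ Set.Iio M from hM), le_refl]
        · refine (h' z hz hM).trans (le_trans ?_ (le_add_self (b := f z.1)))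
          simp only [f', Set.indicator_of_mem (show z.1 ∈ Set.Ici M from hM), le_refl]
    _ = ∫⁻ w, (f + f') w ∂paretoMeasure w₀ (β - 1) := hfst.lintegral_comp (hf.add hf')
    _ = _ := by
        simp only [Pi.add_apply]
        rw [lintegral_add_left hf, lintegral_indicator measurableSet_Iio,
          lintegral_indicator measurableSet_Ici, lintegral_const_mul _ (by fun_prop),
          lintegral_const_mul _ (by fun_prop)]

theorem cliqueProb_succ_le (hβ : 2 < β) (hw₀ : 0 < w₀) (m : ℕ) :
    cliqueProb n β w₀ lam d (m + 1) ≤ (m + 1 : ℕ) * ∫⁻ z, Measure.pi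
      (fun _ => vertexMeasure β w₀ d) (cliqueTuples (girgRel n d lam)
        {y | z.1 ≤ y.1 ∧ girgRel n d lam z y} m) ∂vertexMeasure β w₀ d := by
  have := isProbabilityMeasure_vertexMeasure hβ hw₀ d
  exact measure_cliqueTuples_univ_le (measurableSet_girgRel n d lam) measurable_fst m

theorem vertexMeasure_nbr_pow_le (hβ : 2 < β) (hw₀ : 0 < w₀) (hlam : 0 < lam) (hd : 1 ≤ d)
    {z : ℝ × Torus d} (hz : w₀ ≤ z.1) (m : ℕ) :
    vertexMeasure β w₀ d {y | z.1 ≤ y.1 ∧ girgRel n d lam z y} ^ m ≤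
      ENNReal.ofReal ((nbrConst β w₀ lam / n) ^ m) * ENNReal.ofReal (z.1 ^ ((3 - β) * m)) := by
  have hz0 : 0 < z.1 := hw₀.trans_le hz
  have hK := nbrConst_pos hβ hw₀ hlam
  have h1 : vertexMeasure β w₀ d {y | z.1 ≤ y.1 ∧ girgRel n d lam z y} ≤
      ENNReal.ofReal (nbrConst β w₀ lam / n * z.1 ^ (3 - β)) := by
    refine (vertexMeasure_nbr_le hβ hw₀ hlam hd hz hz).trans_eq ?_
    rw [show (3 - β) = 1 + (2 - β) by ring, Real.rpow_add hz0, Real.rpow_one]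
    congr 1
    ring
  refine (pow_le_pow_left₀ zero_le h1 m).trans_eq ?_
  rw [← ENNReal.ofReal_pow (by positivity), mul_pow, ENNReal.ofReal_mul (by positivity),
    Real.rpow_mul hz0.le, Real.rpow_natCast]

/-- If the expected number of cliques is dominated by vertices of large weight, the vertices
of minimal weight at least `M` have to be treated separately: for them, adjacency is dropped and
only the weights of the other vertices count. -/
theorem cliqueProb_le_of_lt (hβ : 2 < β) (hw₀ : 0 < w₀) (hlam : 0 < lam) (hd : 1 ≤ d) {m : ℕ}
    (hm : β - 1 < (3 - β) * m) {M : ℝ} (hM : w₀ ≤ M) :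
    (cliqueProb n β w₀ lam d (m + 1)).toReal ≤ (m + 1 : ℕ) *
      ((nbrConst β w₀ lam / n) ^ m *
        ((β - 1) * w₀ ^ (β - 1) / ((3 - β) * m - (β - 1)) * M ^ ((3 - β) * m - (β - 1))) +
      (w₀ ^ (β - 1)) ^ m *
        ((β - 1) * w₀ ^ (β - 1) / (β - 1 - (1 - β) * m) * M ^ ((1 - β) * m - (β - 1)))) := by
  have hprob := isProbabilityMeasure_vertexMeasure hβ hw₀ d
  have hK := nbrConst_pos hβ hw₀ hlam
  have hM0 : 0 < M := hw₀.trans_le hM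
  have hα : 0 < β - 1 := by linarith
  have hm' : (1 - β) * m < β - 1 := by
    have : 0 ≤ (β - 1) * m := by positivity
    linarith
  have h1 : 0 < (3 - β) * m - (β - 1) := by linarith
  have h2 : 0 < β - 1 - (1 - β) * m := by linarith
  refine ENNReal.toReal_le_of_le_ofReal (by positivity) ?_
  refine (cliqueProb_succ_le hβ hw₀ m).trans ?_
  rw [ENNReal.ofReal_mul (by positivity), ENNReal.ofReal_natCast]
  gcongr
  refine (lintegral_vertexMeasure_le (M := M) (c := (nbrConst β w₀ lam / n) ^ m)
    (c' := (w₀ ^ (β - 1)) ^ m) (s := (3 - β) * m) (s' := (1 - β) * m) hβ hw₀ ?_ ?_).trans ?_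
  · intro z hz _
    exact (measure_cliqueTuples_le_pow _ m).trans (vertexMeasure_nbr_pow_le hβ hw₀ hlam hd hz m)
  · intro z hz _
    have hz0 : 0 < z.1 := hw₀.trans_le hz
    refine (measure_cliqueTuples_le_pow _ m).trans ?_
    have h3 : vertexMeasure β w₀ d {y | z.1 ≤ y.1 ∧ girgRel n d lam z y} ≤
        ENNReal.ofReal (w₀ ^ (β - 1) * z.1 ^ (1 - β)) :=
      (measure_mono fun y hy => hy.1).trans_eq (vertexMeasure_weight_ge hβ hw₀ hz)
    refine (pow_le_pow_left₀ zero_le h3 m).trans_eq ?_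
    rw [← ENNReal.ofReal_pow (by positivity), mul_pow, ENNReal.ofReal_mul (by positivity),
      Real.rpow_mul hz0.le, Real.rpow_natCast]
  · rw [ENNReal.ofReal_add (by positivity) (by positivity),
      ENNReal.ofReal_mul (p := (nbrConst β w₀ lam / n) ^ m) (by positivity),
      ENNReal.ofReal_mul (p := (w₀ ^ (β - 1)) ^ m) (by positivity)]
    exact add_le_add (mul_le_mul_right (setLIntegral_Iio_rpow_paretoMeasure_le hw₀ hα hM hm) _)
      (mul_le_mul_right (setLIntegral_Ici_rpow_paretoMeasure hw₀ hα hM hm').le _)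

/-- If the expected number of cliques is dominated by vertices of small weight, then the pair gain
applies, except for the cliques all of whose weights are at least `M`. -/
theorem cliqueProb_le_of_gt (hβ : 2 < β) (hw₀ : 0 < w₀) (hlam : 0 < lam) (hd : 1 ≤ d)
    (hn : 1 ≤ n) {m : ℕ} (hm : (3 - β) * m < β - 1) {M : ℝ} (hM : w₀ ≤ M)
    (hM' : lam * M * M / n ≤ (1 / 2) ^ d) :
    (cliqueProb n β w₀ lam d (m + 1)).toReal ≤ (m + 1 : ℕ) *
      ((nbrConst β w₀ lam / n) ^ m * ((β - 1) * w₀ ^ (β - 1) / (β - 1 - (3 - β) * m)) *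
        (3 ^ m * (pairGain β ^ d) ^ (m / 2) * w₀ ^ ((3 - β) * m - (β - 1)) +
          M ^ ((3 - β) * m - (β - 1)))) := by
  have hprob := isProbabilityMeasure_vertexMeasure hβ hw₀ d
  have hK := nbrConst_pos hβ hw₀ hlam
  have hη := pairGain_pos β
  have hM0 : 0 < M := hw₀.trans_le hM
  have hα : 0 < β - 1 := by linarith
  have h2 : 0 < β - 1 - (3 - β) * m := by linarith
  refine ENNReal.toReal_le_of_le_ofReal (by positivity) ?_
  refine (cliqueProb_succ_le hβ hw₀ m).trans ?_
  rw [ENNReal.ofReal_mul (by positivity), ENNReal.ofReal_natCast]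
  gcongr
  refine (lintegral_vertexMeasure_le (M := M)
    (c := 3 ^ m * (pairGain β ^ d) ^ (m / 2) * (nbrConst β w₀ lam / n) ^ m)
    (c' := (nbrConst β w₀ lam / n) ^ m) (s := (3 - β) * m) (s' := (3 - β) * m)
    hβ hw₀ ?_ ?_).trans ?_
  · intro z hz hzM
    have hz0 : 0 < z.1 := hw₀.trans_le hz
    have hzz : lam * z.1 * z.1 / n ≤ (1 / 2) ^ d := by
      refine le_trans ?_ hM'
      gcongr
    refine (measure_cliqueTuples_le_pairs _ m).trans ?_
    have h3 := vertexMeasure_nbr_pow_le (n := n) hβ hw₀ hlam hd hz (m % 2)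
    have h4 := pow_le_pow_left₀ zero_le (measure_pair_le hβ hw₀ hlam hd hn hz hzz) (m / 2)
    refine (mul_le_mul' h4 h3).trans ?_
    rw [← ENNReal.ofReal_pow (by positivity), ← ENNReal.ofReal_mul (by positivity),
      ← ENNReal.ofReal_mul (by positivity), ← ENNReal.ofReal_mul (by positivity)]
    refine ENNReal.ofReal_le_ofReal ?_
    rw [Real.rpow_mul hz0.le, Real.rpow_mul hz0.le, Real.rpow_natCast, Real.rpow_natCast]
    set κ := nbrConst β w₀ lam / n with hκ
    set y := z.1 ^ (3 - β) with hy
    have hκ0 : 0 ≤ κ := by positivity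
    have hy0 : 0 ≤ y := by positivity
    have h5 : (κ * y) ^ m = ((κ * y) ^ 2) ^ (m / 2) * (κ * y) ^ (m % 2) := by
      rw [← pow_mul, ← pow_add, Nat.div_add_mod]
    calc _ = 3 ^ (m / 2) * (pairGain β ^ d) ^ (m / 2) *
          (((κ * y) ^ 2) ^ (m / 2) * (κ * y) ^ (m % 2)) := by
          rw [show nbrConst β w₀ lam * y / n = κ * y by rw [hκ]; ring]
          rw [mul_pow _ _ (m / 2), mul_pow _ _ (m / 2), mul_pow κ y (m % 2)]
          ring
      _ = 3 ^ (m / 2) * (pairGain β ^ d) ^ (m / 2) * (κ * y) ^ m := by rw [h5]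
      _ ≤ 3 ^ m * (pairGain β ^ d) ^ (m / 2) * (κ * y) ^ m := by
          gcongr
          · norm_num
          · exact Nat.div_le_self m 2
      _ = _ := by rw [mul_pow κ y]; ring
  · intro z hz _
    exact (measure_cliqueTuples_le_pow _ m).trans (vertexMeasure_nbr_pow_le hβ hw₀ hlam hd hz m)
  · have h3 : ∫⁻ w in Set.Iio M, ENNReal.ofReal (w ^ ((3 - β) * m)) ∂paretoMeasure w₀ (β - 1) ≤
        ENNReal.ofReal ((β - 1) * w₀ ^ (β - 1) / (β - 1 - (3 - β) * m) *
          w₀ ^ ((3 - β) * m - (β - 1))) := by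
      rw [← setLIntegral_Ici_rpow_paretoMeasure hw₀ hα le_rfl hm]
      refine lintegral_mono' (Measure.restrict_mono_ae ?_) le_rfl
      filter_upwards [ae_le_paretoMeasure] with w hw _ using hw
    rw [setLIntegral_Ici_rpow_paretoMeasure hw₀ hα hM hm]
    refine (add_le_add_left (mul_le_mul_right h3 _) _).trans_eq ?_
    rw [← ENNReal.ofReal_mul (by positivity), ← ENNReal.ofReal_mul (by positivity),
      ← ENNReal.ofReal_add (by positivity) (by positivity)]
    congr 1
    ring

theorem dist_torus_le_half (x y : Torus d) : dist x y ≤ 1 / 2 := by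
  refine (dist_pi_le_iff (by norm_num)).2 fun i => ?_
  rw [dist_eq_norm]
  simpa using AddCircle.norm_le_half_period 1 (x := x i - y i) one_ne_zero

/-- Vertices of weight at least `√(n / lam)` are always adjacent. -/
theorem le_cliqueProb_of_weights (hβ : 2 < β) (hw₀ : 0 < w₀) (hlam : 0 < lam) (hn : 1 ≤ n)
    (k : ℕ) {M : ℝ} (hM : w₀ ≤ M) (hM' : n ≤ lam * M * M) :
    (w₀ ^ (β - 1) * M ^ (1 - β)) ^ k ≤ (cliqueProb n β w₀ lam d k).toReal := by
  have hprob := isProbabilityMeasure_vertexMeasure hβ hw₀ d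
  have hM0 : 0 < M := hw₀.trans_le hM
  have hn' : (0 : ℝ) < n := by exact_mod_cast hn
  refine (ENNReal.ofReal_le_iff_le_toReal (measure_ne_top _ _)).1 ?_
  calc _ = Measure.pi (fun _ : Fin k => vertexMeasure β w₀ d)
        (Set.univ.pi fun _ => {y | M ≤ y.1}) := by
        rw [Measure.pi_pi, Finset.prod_const, vertexMeasure_weight_ge hβ hw₀ hM,
          ENNReal.ofReal_pow (by positivity), Finset.card_univ, Fintype.card_fin]
    _ ≤ _ := by
        refine measure_mono fun y hy => ⟨fun _ => trivial, fun i j _ => ?_⟩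
        have hi : M ≤ (y i).1 := hy i trivial
        have hj : M ≤ (y j).1 := hy j trivial
        have hi0 : 0 < (y i).1 := hM0.trans_le hi
        refine (dist_torus_le_half _ _).trans ?_
        have h1 : 1 ≤ lam * (y i).1 * (y j).1 / n := by
          rw [one_le_div hn']
          refine hM'.trans ?_
          gcongr
        have := Real.one_le_rpow h1 (show (0 : ℝ) ≤ 1 / d by positivity)
        unfold connThreshold
        linarith

/-- Vertices within half of the smallest possible connection threshold of a given vertex form a
clique. -/
theorem le_cliqueProb_of_positions (hβ : 2 < β) (hw₀ : 0 < w₀) (hlam : 0 < lam) (hd : 1 ≤ d)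
    (hn : lam * w₀ * w₀ ≤ n) (m : ℕ) :
    ((1 / 2) ^ d * (lam * w₀ * w₀ / n)) ^ m ≤ (cliqueProb n β w₀ lam d (m + 1)).toReal := by
  have hprob := isProbabilityMeasure_vertexMeasure hβ hw₀ d
  have hprob' := isProbabilityMeasure_paretoMeasure hw₀ (show 0 < β - 1 by linarith)
  have hn' : (0 : ℝ) < n := lt_of_lt_of_le (by positivity) hn
  set t := connThreshold n d lam w₀ w₀ with ht
  have ht0 : 0 ≤ t := connThreshold_nonneg hlam.le hw₀.le hw₀.le
  have htd : (2 * t) ^ d = lam * w₀ * w₀ / n := two_mul_connThreshold_pow hd hlam.le hw₀.le hw₀.le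
  have ht1 : t ≤ 1 := by
    have : 2 * t ≤ 1 := by
      rw [← pow_le_pow_iff_left₀ (by positivity) zero_le_one (show d ≠ 0 by omega), htd, one_pow,
        div_le_one hn']
      exact hn
    linarith
  refine (ENNReal.ofReal_le_iff_le_toReal (measure_ne_top _ _)).1 ?_
  set D : Set ((ℝ × Torus d) × (Fin m → ℝ × Torus d)) :=
    {p | w₀ ≤ p.1.1 ∧ ∀ i, w₀ ≤ (p.2 i).1 ∧ dist p.1.2 (p.2 i).2 ≤ t / 2} with hD
  have hDm : MeasurableSet D := by
    have : D = {p | w₀ ≤ p.1.1} ∩ ⋂ i, ({p | w₀ ≤ (p.2 i).1} ∩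
        {p | dist p.1.2 (p.2 i).2 ≤ t / 2}) := by
      ext p
      simp [hD]
    rw [this]
    refine (measurableSet_le (by fun_prop) (by fun_prop)).inter (.iInter fun i =>
      (measurableSet_le (by fun_prop) (by fun_prop)).inter
      (measurableSet_le (by fun_prop) (by fun_prop)))
  have hadj : ∀ x y : ℝ × Torus d, w₀ ≤ x.1 → w₀ ≤ y.1 → dist x.2 y.2 ≤ t → girgRel n d lam x y := by
    intro x y hx hy hxy
    have hx0 : 0 < x.1 := hw₀.trans_le hx
    refine hxy.trans ?_
    rw [ht]
    unfold connThreshold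
    gcongr
  have hsub : (MeasurableEquiv.piFinSuccAbove (fun _ => ℝ × Torus d) (0 : Fin (m + 1))) ⁻¹' D ⊆
      cliqueTuples (girgRel n d lam) Set.univ (m + 1) := by
    rintro y ⟨h0, hy⟩
    have hy' : ∀ i, w₀ ≤ (y i).1 ∧ dist (y 0).2 (y i).2 ≤ t / 2 := by
      intro i
      refine Fin.cases ⟨h0, ?_⟩ hy i
      rw [dist_self]
      positivity
    refine ⟨fun _ => trivial, fun i j _ => hadj _ _ (hy' i).1 (hy' j).1 ?_⟩
    have h1 := dist_triangle_left (y i).2 (y j).2 (y 0).2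
    linarith [(hy' i).2, (hy' j).2]
  have hball : ∀ x : Torus d, vertexMeasure β w₀ d {y | w₀ ≤ y.1 ∧ dist x y.2 ≤ t / 2} =
      ENNReal.ofReal ((1 / 2) ^ d * (lam * w₀ * w₀ / n)) := by
    intro x
    have h1 : {y : ℝ × Torus d | w₀ ≤ y.1 ∧ dist x y.2 ≤ t / 2} =
        Set.Ici w₀ ×ˢ Metric.closedBall x (t / 2) := by
      ext y
      simp [dist_comm]
    have h2 : paretoMeasure w₀ (β - 1) (Set.Ici w₀) = 1 :=
      prob_compl_eq_zero_iff measurableSet_Ici |>.1 ae_le_paretoMeasure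
    rw [h1, vertexMeasure, Measure.prod_prod, h2, one_mul,
      volume_torus_closedBall _ (by positivity), mul_div_cancel₀ _ two_ne_zero, min_eq_right ht1,
      ← ENNReal.ofReal_pow ht0, ← htd, ← mul_pow]
    congr 2
    ring
  refine le_trans ?_ (measure_mono hsub)
  rw [(measurePreserving_piFinSuccAbove (fun _ => vertexMeasure β w₀ d)
    0).measure_preimage_equiv, Measure.prod_apply hDm]
  have hae : ∀ᵐ z ∂vertexMeasure β w₀ d, Measure.pi (fun _ : Fin m => vertexMeasure β w₀ d)
      (Prod.mk z ⁻¹' D) = ENNReal.ofReal (((1 / 2) ^ d * (lam * w₀ * w₀ / n)) ^ m) := by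
    filter_upwards [ae_le_vertexMeasure hβ hw₀ d] with z hz
    have : Prod.mk z ⁻¹' D = Set.univ.pi fun _ => {y | w₀ ≤ y.1 ∧ dist z.2 y.2 ≤ t / 2} := by
      ext y
      simp [hD, hz]
    rw [this, Measure.pi_pi, Finset.prod_const, hball, ENNReal.ofReal_pow (by positivity),
      Finset.card_univ, Fintype.card_fin]
  rw [lintegral_congr_ae hae]
  simp

end CliqueProb

/-! ### Sequences of at most exponential growth -/

/-- A sequence is at most exponential if it is bounded by `C ^ k` for some constant `C` and all
`k ≥ 1`. The factors of this kind are absorbed by the base of `(b * k) ^ (-k)`. -/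
def AtMostExponential (f : ℕ → ℝ) : Prop := ∃ C > 0, ∀ k, 1 ≤ k → |f k| ≤ C ^ k

namespace AtMostExponential

variable {f g : ℕ → ℝ}

theorem const (c : ℝ) : AtMostExponential fun _ => c := by
  refine ⟨max 1 |c|, by positivity, fun k hk => ?_⟩
  exact (le_max_right 1 |c|).trans (le_self_pow₀ (le_max_left _ _) (by omega))

theorem pow (c : ℝ) : AtMostExponential fun k => c ^ k := by
  refine ⟨max 1 |c|, by positivity, fun k _ => ?_⟩
  rw [abs_pow]
  gcongr
  exact le_max_right _ _

theorem natCast : AtMostExponential fun k => (k : ℝ) := by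
  refine ⟨2, by norm_num, fun k _ => ?_⟩
  rw [Nat.abs_cast]
  exact_mod_cast k.lt_two_pow_self.le

theorem mul (hf : AtMostExponential f) (hg : AtMostExponential g) :
    AtMostExponential fun k => f k * g k := by
  obtain ⟨C, hC, hf⟩ := hf
  obtain ⟨D, hD, hg⟩ := hg
  refine ⟨C * D, by positivity, fun k hk => ?_⟩
  rw [abs_mul, mul_pow]
  exact mul_le_mul (hf k hk) (hg k hk) (abs_nonneg _) (by positivity)

theorem add (hf : AtMostExponential f) (hg : AtMostExponential g) :
    AtMostExponential fun k => f k + g k := by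
  obtain ⟨C, hC, hf⟩ := hf
  obtain ⟨D, hD, hg⟩ := hg
  refine ⟨C + D, by positivity, fun k hk => (abs_add_le _ _).trans ?_⟩
  exact (add_le_add (hf k hk) (hg k hk)).trans (pow_add_pow_le hC.le hD.le (by omega))

theorem rpow_affine {c : ℝ} (hc : 0 < c) (a b : ℝ) :
    AtMostExponential fun k => c ^ (a * k + b) := by
  have : (fun k : ℕ => c ^ (a * k + b)) = fun k : ℕ => (c ^ a) ^ k * c ^ b := by
    funext k
    rw [Real.rpow_add hc, Real.rpow_mul hc.le, Real.rpow_natCast]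
  rw [this]
  exact (pow _).mul (const _)

end AtMostExponential

/-! ### Bounds on the expected number of cliques -/

theorem choose_le_exp_mul_div_pow {n k : ℕ} (hk : 1 ≤ k) :
    (n.choose k : ℝ) ≤ (n : ℝ) ^ k * Real.exp 1 ^ k / (k : ℝ) ^ k := by
  have hk' : (0 : ℝ) < k := by exact_mod_cast hk
  have h1 := Real.pow_div_factorial_le_exp (k : ℝ) hk'.le k
  rw [div_le_iff₀ (by positivity)] at h1
  refine (Nat.choose_le_pow_div k n).trans ?_
  rw [div_le_div_iff₀ (by positivity) (by positivity), ← Real.exp_nat_mul, mul_one, mul_assoc]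
  gcongr

theorem div_pow_le_choose {n k : ℕ} (hk : 1 ≤ k) (hkn : k ≤ n) :
    ((n : ℝ) / k) ^ k ≤ n.choose k := by
  have hk' : (0 : ℝ) < k := by exact_mod_cast hk
  have h1 : (n : ℝ) ^ k * k.factorial ≤ n.descFactorial k * (k : ℝ) ^ k := by
    have hp : ∀ x : ℝ, x ^ k = ∏ _i ∈ Finset.range k, x := by simp
    rw [← Nat.descFactorial_self k, Nat.descFactorial_eq_prod_range,
      Nat.descFactorial_eq_prod_range, hp, hp]
    push_cast
    rw [← Finset.prod_mul_distrib, ← Finset.prod_mul_distrib]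
    refine Finset.prod_le_prod (fun i _ => by positivity) fun i hi => ?_
    have hi' := (Finset.mem_range.1 hi).le
    rw [Nat.cast_sub hi', Nat.cast_sub (hi'.trans hkn)]
    have : (k : ℝ) ≤ n := by exact_mod_cast hkn
    have : (0 : ℝ) ≤ i := i.cast_nonneg
    nlinarith
  rw [div_pow, div_le_iff₀ (by positivity), Nat.choose_eq_descFactorial_div_factorial,
    Nat.cast_div (Nat.factorial_dvd_descFactorial n k) (by positivity), div_mul_eq_mul_div,
    le_div_iff₀ (by positivity)]
  exact h1

section Expected

variable {β w₀ lam : ℝ}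

theorem sqrt_rpow {x : ℝ} (hx : 0 ≤ x) (p : ℝ) : √x ^ p = x ^ (p / 2) := by
  rw [Real.sqrt_eq_rpow, ← Real.rpow_mul hx]
  congr 1
  ring

/-- The regime dominated by vertices of weight of order `√n`, which is the threshold used to
split the clique probability. -/
theorem exists_expectedCliques_le_of_large (hβ : 2 < β) (hw₀ : 0 < w₀) (hlam : 0 < lam)
    {δ : ℝ} (hδ : 0 < δ) :
    ∃ b > 0, ∀ n d k : ℕ, 1 ≤ n → 1 ≤ d → 1 ≤ k → lam * w₀ * w₀ ≤ n → 2 + δ ≤ (3 - β) * k →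
      expectedCliques n β w₀ lam d k ≤
        (n : ℝ) ^ ((k : ℝ) / 2 * (3 - β)) * (b * k) ^ (-(k : ℤ)) := by
  have hK := nbrConst_pos hβ hw₀ hlam
  set K := nbrConst β w₀ lam with hKdef
  set c := (β - 1) * w₀ ^ (β - 1) with hc
  have hα : 0 < β - 1 := by linarith
  have hc0 : 0 < c := by positivity
  obtain ⟨C, hC, hG⟩ : AtMostExponential fun k : ℕ => k *
      (K ^ k * (K⁻¹ * (c / δ)) * lam ^ (-(3 - β) / 2 * k + 1) +
        (w₀ ^ (β - 1)) ^ k * ((w₀ ^ (β - 1))⁻¹ * (c / (β - 1))) *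
          lam ^ ((β - 1) / 2 * k + 0)) :=
    .mul .natCast (.add (.mul (.mul (.pow _) (.const _)) (.rpow_affine hlam _ _))
      (.mul (.mul (.pow _) (.const _)) (.rpow_affine hlam _ _)))
  refine ⟨(Real.exp 1 * C)⁻¹, by positivity, fun n d k hn hd hk hn' hδk => ?_⟩
  have hn0 : (0 : ℝ) < n := by exact_mod_cast hn
  have hk0 : (0 : ℝ) < k := by exact_mod_cast hk
  obtain ⟨m, rfl⟩ : ∃ m, k = m + 1 := ⟨k - 1, by omega⟩
  have hmk : (m : ℝ) = ((m + 1 : ℕ) : ℝ) - 1 := by push_cast; ring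
  have e1 : (3 - β) * m - (β - 1) = (3 - β) * (m + 1 : ℕ) - 2 := by rw [hmk]; ring
  have e2 : (1 - β) * m - (β - 1) = (1 - β) * (m + 1 : ℕ) := by rw [hmk]; ring
  have e3 : β - 1 - (1 - β) * m = (β - 1) * (m + 1 : ℕ) := by rw [hmk]; ring
  have hM : w₀ ≤ √(n / lam) := by
    refine Real.le_sqrt_of_sq_le ?_
    rw [le_div_iff₀ hlam]
    linarith
  have h1 := cliqueProb_le_of_lt (n := n) hβ hw₀ hlam hd (m := m) (by linarith) hM
  rw [e1, e2, e3, sqrt_rpow (by positivity), sqrt_rpow (by positivity), ← hKdef, ← hc] at h1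
  have h2 := (le_abs_self _).trans (hG (m + 1) hk)
  beta_reduce at h2
  set k := m + 1
  -- all powers of `n` combine to `n ^ ((1 - β) * k / 2)`
  have h3 : (cliqueProb n β w₀ lam d k).toReal ≤ (n : ℝ) ^ ((1 - β) * k / 2) * C ^ k := by
    refine h1.trans (le_trans ?_ (mul_le_mul_of_nonneg_left h2 (by positivity)))
    have t1 : (K / n) ^ m * (c / ((3 - β) * k - 2) * ((n : ℝ) / lam) ^ (((3 - β) * k - 2) / 2)) ≤
        (n : ℝ) ^ ((1 - β) * k / 2) *
          (K ^ k * (K⁻¹ * (c / δ)) * lam ^ (-(3 - β) / 2 * k + 1)) := by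
      calc _ ≤ (K / n) ^ m * (c / δ * ((n : ℝ) / lam) ^ (((3 - β) * k - 2) / 2)) := by
            gcongr
            linarith
        _ = _ := by
            have s1 : (K / n) ^ m = K ^ k * K⁻¹ * (n : ℝ) ^ (-(m : ℝ)) := by
              rw [Real.rpow_neg hn0.le, Real.rpow_natCast, div_pow, pow_succ K m]
              field_simp
            have s2 : (n : ℝ) ^ ((1 - β) * k / 2) =
                (n : ℝ) ^ (-(m : ℝ)) * (n : ℝ) ^ (((3 - β) * k - 2) / 2) := by
              rw [← Real.rpow_add hn0, hmk]
              congr 1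
              ring
            have s3 : lam ^ (-(3 - β) / 2 * k + 1) = (lam ^ (((3 - β) * k - 2) / 2))⁻¹ := by
              rw [← Real.rpow_neg hlam.le]
              congr 1
              ring
            rw [s1, s2, s3, Real.div_rpow hn0.le hlam.le]
            ring
    have t2 : (w₀ ^ (β - 1)) ^ m * (c / ((β - 1) * k) * ((n : ℝ) / lam) ^ ((1 - β) * k / 2)) ≤
        (n : ℝ) ^ ((1 - β) * k / 2) * ((w₀ ^ (β - 1)) ^ k * ((w₀ ^ (β - 1))⁻¹ * (c / (β - 1))) *
          lam ^ ((β - 1) / 2 * k + 0)) := by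
      have hk1 : (1 : ℝ) ≤ k := by exact_mod_cast hk
      calc _ ≤ (w₀ ^ (β - 1)) ^ m * (c / (β - 1) * ((n : ℝ) / lam) ^ ((1 - β) * k / 2)) := by
            gcongr
            nlinarith
        _ = _ := by
            have s1 : (w₀ ^ (β - 1)) ^ m = (w₀ ^ (β - 1)) ^ k * (w₀ ^ (β - 1))⁻¹ := by
              have : w₀ ^ (β - 1) ≠ 0 := by positivity
              rw [pow_succ _ m]
              field_simp
            have s3 : lam ^ ((β - 1) / 2 * k + 0) = (lam ^ ((1 - β) * k / 2))⁻¹ := by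
              rw [← Real.rpow_neg hlam.le]
              congr 1
              ring
            rw [s1, s3, Real.div_rpow hn0.le hlam.le]
            ring
    calc _ ≤ (k : ℝ) * (_ + _) := mul_le_mul_of_nonneg_left (add_le_add t1 t2) hk0.le
      _ = _ := by ring
  rw [expectedCliques_eq hβ hw₀]
  calc _ ≤ ((n : ℝ) ^ k * Real.exp 1 ^ k / (k : ℝ) ^ k) *
        ((n : ℝ) ^ ((1 - β) * k / 2) * C ^ k) := by
        gcongr
        exact choose_le_exp_mul_div_pow hk
    _ = _ := by
        have s1 : (n : ℝ) ^ ((k : ℝ) / 2 * (3 - β)) = (n : ℝ) ^ k * (n : ℝ) ^ ((1 - β) * k / 2) := by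
          rw [← Real.rpow_natCast, ← Real.rpow_add hn0]
          congr 1
          ring
        rw [zpow_neg, zpow_natCast, s1, mul_pow, inv_pow, mul_inv, inv_inv, mul_pow]
        ring

/-- The regime dominated by vertices of constant weight. The second summand stems from cliques all
of whose weights are at least `√(n / (lam * 2 ^ d))`, where connection thresholds are too large for
the pair gain. -/
theorem exists_expectedCliques_le_of_small (hβ : 2 < β) (hw₀ : 0 < w₀) (hlam : 0 < lam)
    {δ : ℝ} (hδ : 0 < δ) :
    ∃ a > 0, ∃ C > 0, ∀ n d k : ℕ, 1 ≤ n → 1 ≤ d → 3 ≤ k → lam * w₀ * w₀ * 2 ^ d ≤ n →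
      (3 - β) * k + δ ≤ 2 → expectedCliques n β w₀ lam d k ≤ n * (C / k) ^ k *
        (Real.exp (-(a * d * k)) + ((n : ℝ) / 2 ^ d) ^ (((3 - β) * k - 2) / 2)) := by
  have hK := nbrConst_pos hβ hw₀ hlam
  set K := nbrConst β w₀ lam with hKdef
  set c := (β - 1) * w₀ ^ (β - 1) with hc
  have hα : 0 < β - 1 := by linarith
  have hc0 : 0 < c := by positivity
  obtain ⟨C, hC, hG⟩ : AtMostExponential fun k : ℕ => k *
      (K ^ k * (K⁻¹ * (c / δ)) * (3 ^ k * w₀ ^ ((3 - β) * k + -2) +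
        lam ^ (-(3 - β) / 2 * k + 1))) :=
    .mul .natCast (.mul (.mul (.pow _) (.const _)) (.add (.mul (.pow _) (.rpow_affine hw₀ _ _))
      (.rpow_affine hlam _ _)))
  have hη := pairGain_pos β
  refine ⟨-Real.log (pairGain β) / 6, ?_, Real.exp 1 * C, by positivity,
    fun n d k hn hd hk hn' hδk => ?_⟩
  · have := Real.log_neg hη (pairGain_lt_one hβ)
    linarith
  have hn0 : (0 : ℝ) < n := by exact_mod_cast hn
  have hk0 : (0 : ℝ) < k := by exact_mod_cast (by omega : 0 < k)
  obtain ⟨m, rfl⟩ : ∃ m, k = m + 1 := ⟨k - 1, by omega⟩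
  have hmk : (m : ℝ) = ((m + 1 : ℕ) : ℝ) - 1 := by push_cast; ring
  have e1 : (3 - β) * m - (β - 1) = (3 - β) * (m + 1 : ℕ) - 2 := by rw [hmk]; ring
  have e3 : β - 1 - (3 - β) * m = 2 - (3 - β) * (m + 1 : ℕ) := by rw [hmk]; ring
  have hM : w₀ ≤ √(n / 2 ^ d / lam) := by
    refine Real.le_sqrt_of_sq_le ?_
    rw [le_div_iff₀ hlam, le_div_iff₀ (by positivity)]
    linarith
  have hM' : lam * √(n / 2 ^ d / lam) * √(n / 2 ^ d / lam) / n ≤ (1 / 2) ^ d := by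
    rw [mul_assoc, Real.mul_self_sqrt (by positivity), one_div, inv_pow]
    refine le_of_eq ?_
    field_simp
  have h1 := cliqueProb_le_of_gt hβ hw₀ hlam hd hn (m := m) (by linarith) hM hM'
  rw [e1, e3, sqrt_rpow (by positivity), ← hKdef, ← hc] at h1
  have h2 := (le_abs_self _).trans (hG (m + 1) (by omega))
  beta_reduce at h2
  set k := m + 1
  set x := Real.exp (-(-Real.log (pairGain β) / 6 * d * k)) with hx
  set y := ((n : ℝ) / 2 ^ d) ^ (((3 - β) * k - 2) / 2) with hy
  have hgain : (pairGain β ^ d) ^ (m / 2) ≤ x := by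
    have s1 : (pairGain β ^ d) ^ (m / 2) = Real.exp (Real.log (pairGain β) * (d * (m / 2 : ℕ))) := by
      rw [← pow_mul, ← Nat.cast_mul, mul_comm (Real.log _), Real.exp_nat_mul, Real.exp_log hη]
    rw [s1, hx]
    refine Real.exp_le_exp.2 ?_
    have s2 : (k : ℝ) ≤ 6 * (m / 2 : ℕ) := by
      have : k ≤ 6 * (m / 2) := by omega
      exact_mod_cast this
    have s3 : Real.log (pairGain β) * d ≤ 0 :=
      mul_nonpos_of_nonpos_of_nonneg (Real.log_neg hη (pairGain_lt_one hβ)).le d.cast_nonneg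
    nlinarith
  have h3 : (cliqueProb n β w₀ lam d k).toReal ≤ ((n : ℝ) ^ m)⁻¹ * C ^ k * (x + y) := by
    have hx0 : 0 < x := Real.exp_pos _
    have hy0 : 0 < y := by positivity
    refine h1.trans (le_trans ?_ (mul_le_mul_of_nonneg_right
      (mul_le_mul_of_nonneg_left h2 (by positivity)) (by positivity)))
    have s1 : (K / n) ^ m = K ^ k * K⁻¹ * ((n : ℝ) ^ m)⁻¹ := by
      rw [div_pow, pow_succ K m]
      field_simp
    have s3 : ((n : ℝ) / 2 ^ d / lam) ^ (((3 - β) * k - 2) / 2) =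
        y * lam ^ (-(3 - β) / 2 * k + 1) := by
      rw [Real.div_rpow (by positivity) hlam.le, div_eq_mul_inv, ← Real.rpow_neg hlam.le]
      congr 2
      ring
    rw [s1, s3, show (3 - β) * (k : ℝ) + -2 = (3 - β) * k - 2 by ring]
    set u := w₀ ^ ((3 - β) * (k : ℝ) - 2)
    set v := lam ^ (-(3 - β) / 2 * (k : ℝ) + 1)
    have hu : 0 < u := by positivity
    have hv : 0 < v := by positivity
    calc _ ≤ (k : ℝ) * (K ^ k * K⁻¹ * ((n : ℝ) ^ m)⁻¹ * (c / δ) * (3 ^ k * x * u + y * v)) := by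
          gcongr
          · linarith
          · norm_num
          · omega
      _ = ((n : ℝ) ^ m)⁻¹ * (k * (K ^ k * (K⁻¹ * (c / δ)))) * (3 ^ k * u * x + v * y) := by ring
      _ ≤ ((n : ℝ) ^ m)⁻¹ * (k * (K ^ k * (K⁻¹ * (c / δ)))) * ((3 ^ k * u + v) * (x + y)) := by
          gcongr
          have : 0 ≤ 3 ^ k * u * y + v * x := by positivity
          linarith
      _ = _ := by ring
  rw [expectedCliques_eq hβ hw₀]
  calc _ ≤ ((n : ℝ) ^ k * Real.exp 1 ^ k / (k : ℝ) ^ k) * (((n : ℝ) ^ m)⁻¹ * C ^ k * (x + y)) := by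
        gcongr
        exact choose_le_exp_mul_div_pow (by omega)
    _ = _ := by
        rw [pow_succ (n : ℝ) m, div_pow, mul_pow]
        field_simp

theorem le_expectedCliques_of_large (hβ : 2 < β) (hw₀ : 0 < w₀) (hlam : 0 < lam) {n d k : ℕ}
    (hn : 1 ≤ n) (hk : 1 ≤ k) (hkn : k ≤ n) (hn' : lam * w₀ * w₀ ≤ n) {B : ℝ}
    (hB : (w₀ ^ (β - 1) * lam ^ ((β - 1) / 2))⁻¹ ≤ B) :
    (n : ℝ) ^ ((k : ℝ) / 2 * (3 - β)) * (B * k) ^ (-(k : ℤ)) ≤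
      expectedCliques n β w₀ lam d k := by
  have hn0 : (0 : ℝ) < n := by exact_mod_cast hn
  have hk0 : (0 : ℝ) < k := by exact_mod_cast hk
  have hB0 : 0 < B := lt_of_lt_of_le (by positivity) hB
  have hM : w₀ ≤ √(n / lam) := by
    refine Real.le_sqrt_of_sq_le ?_
    rw [le_div_iff₀ hlam]
    linarith
  have hM' : (n : ℝ) ≤ lam * √(n / lam) * √(n / lam) := by
    rw [mul_assoc, Real.mul_self_sqrt (by positivity), mul_div_cancel₀ _ hlam.ne']
  have h1 := le_cliqueProb_of_weights (d := d) hβ hw₀ hlam hn k hM hM'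
  rw [sqrt_rpow (by positivity)] at h1
  rw [expectedCliques_eq hβ hw₀]
  refine le_trans ?_ (mul_le_mul (div_pow_le_choose hk hkn) h1 (by positivity) (by positivity))
  have s1 : (n : ℝ) ^ ((k : ℝ) / 2 * (3 - β)) = (n : ℝ) ^ k * ((n : ℝ) ^ ((1 - β) / 2)) ^ k := by
    rw [← Real.rpow_natCast, ← Real.rpow_natCast, ← Real.rpow_mul hn0.le, ← Real.rpow_add hn0]
    congr 1
    ring
  have s2 : ((n : ℝ) / lam) ^ ((1 - β) / 2) = (n : ℝ) ^ ((1 - β) / 2) * lam ^ ((β - 1) / 2) := by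
    rw [Real.div_rpow hn0.le hlam.le, div_eq_mul_inv, ← Real.rpow_neg hlam.le]
    congr 2
    ring
  rw [zpow_neg, zpow_natCast, s1, s2, ← inv_pow, ← mul_pow, ← mul_pow, ← mul_pow]
  refine pow_le_pow_left₀ (by positivity) ?_ k
  have hB' : B⁻¹ ≤ w₀ ^ (β - 1) * lam ^ ((β - 1) / 2) := inv_le_of_inv_le₀ (by positivity) hB
  calc _ = (n : ℝ) / k * (n : ℝ) ^ ((1 - β) / 2) * B⁻¹ := by
        rw [mul_inv]
        ring
    _ ≤ (n : ℝ) / k * (n : ℝ) ^ ((1 - β) / 2) * (w₀ ^ (β - 1) * lam ^ ((β - 1) / 2)) := by gcongr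
    _ = _ := by ring

theorem le_expectedCliques_of_small (hβ : 2 < β) (hw₀ : 0 < w₀) (hlam : 0 < lam) {n d k : ℕ}
    (hd : 1 ≤ d) (hn : 1 ≤ n) (hk : 1 ≤ k) (hkn : k ≤ n) (hn' : lam * w₀ * w₀ ≤ n) {B : ℝ}
    (hB1 : 1 ≤ B) (hB : (lam * w₀ * w₀)⁻¹ ≤ B) :
    (n : ℝ) * Real.exp (-(1 * d * k)) * (B * k) ^ (-(k : ℤ)) ≤
      expectedCliques n β w₀ lam d k := by
  have hn0 : (0 : ℝ) < n := by exact_mod_cast hn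
  have hk0 : (0 : ℝ) < k := by exact_mod_cast hk
  have hB0 : 0 < B := by linarith
  obtain ⟨m, rfl⟩ : ∃ m, k = m + 1 := ⟨k - 1, by omega⟩
  have h1 := le_cliqueProb_of_positions hβ hw₀ hlam hd hn' m
  set k := m + 1
  rw [expectedCliques_eq hβ hw₀]
  refine le_trans ?_ (mul_le_mul (div_pow_le_choose hk hkn) h1 (by positivity) (by positivity))
  have hB' : B⁻¹ ≤ lam * w₀ * w₀ := inv_le_of_inv_le₀ (by positivity) hB
  have s1 : (B⁻¹) ^ k ≤ (lam * w₀ * w₀) ^ m := by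
    calc (B⁻¹) ^ k ≤ (B⁻¹) ^ m := pow_le_pow_of_le_one (by positivity) (inv_le_one_of_one_le₀ hB1)
          (by omega)
      _ ≤ _ := by gcongr
  have s2 : Real.exp (-(1 * d * k)) ≤ ((1 / 2) ^ d) ^ m := by
    have h2 : Real.exp (-1) ≤ 1 / 2 := by
      rw [Real.exp_neg, one_div]
      have := Real.add_one_le_exp (1 : ℝ)
      gcongr
      linarith
    calc Real.exp (-(1 * d * k)) = Real.exp (-1) ^ (d * k) := by
          rw [← Real.exp_nat_mul]
          congr 1
          push_cast
          ring
      _ ≤ Real.exp (-1) ^ (d * m) := pow_le_pow_of_le_one (Real.exp_pos _).le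
          (Real.exp_le_one_iff.2 (by norm_num)) (by gcongr; omega)
      _ ≤ (1 / 2) ^ (d * m) := by gcongr
      _ = _ := pow_mul _ _ _
  rw [zpow_neg, zpow_natCast, mul_pow, mul_inv, ← inv_pow]
  calc _ ≤ (n : ℝ) * ((1 / 2) ^ d) ^ m * ((lam * w₀ * w₀) ^ m * ((k : ℝ) ^ k)⁻¹) := by gcongr
    _ = _ := by
        rw [mul_pow ((1 / 2 : ℝ) ^ d) _ m, div_pow (lam * w₀ * w₀) _ m, div_pow (n : ℝ),
          pow_succ (n : ℝ) m]
        field_simp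

end Expected

/-! ### Asymptotics -/

/-- The integers `k` with `(3 - β) * k < 2` stay away from equality. -/
theorem exists_gap_below (β : ℝ) : ∃ δ > 0, ∀ k : ℕ,
    ((β < 3 ∧ (k : ℝ) < 2 / (3 - β)) ∨ 3 ≤ β) → (3 - β) * k + δ ≤ 2 := by
  rcases lt_or_ge β 3 with hβ | hβ
  · have h3 : 0 < 3 - β := by linarith
    have hpos : 0 < ⌈2 / (3 - β)⌉₊ := Nat.ceil_pos.2 (by positivity)
    have hlt : ((⌈2 / (3 - β)⌉₊ - 1 : ℕ) : ℝ) < 2 / (3 - β) := Nat.lt_ceil.1 (by omega)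
    rw [lt_div_iff₀ h3] at hlt
    refine ⟨2 - (⌈2 / (3 - β)⌉₊ - 1 : ℕ) * (3 - β), by linarith, fun k hk => ?_⟩
    have hk' : (k : ℝ) < 2 / (3 - β) := by
      rcases hk with hk | hk
      · exact hk.2
      · linarith
    have : (k : ℝ) ≤ (⌈2 / (3 - β)⌉₊ - 1 : ℕ) := by
      have := Nat.lt_ceil.2 hk'
      exact_mod_cast (by omega : k ≤ ⌈2 / (3 - β)⌉₊ - 1)
    nlinarith
  · refine ⟨2, by norm_num, fun k _ => ?_⟩
    have : 0 ≤ (β - 3) * k := mul_nonneg (by linarith) k.cast_nonneg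
    linarith

/-- The integers `k` with `(3 - β) * k > 2` stay away from equality. -/
theorem exists_gap_above (β : ℝ) : ∃ δ > 0, ∀ k : ℕ,
    β < 3 → 2 / (3 - β) < (k : ℝ) → 2 + δ ≤ (3 - β) * k := by
  rcases lt_or_ge β 3 with hβ | hβ
  · have h3 : 0 < 3 - β := by linarith
    have hlt := Nat.lt_floor_add_one (2 / (3 - β))
    rw [div_lt_iff₀ h3] at hlt
    refine ⟨(⌊2 / (3 - β)⌋₊ + 1) * (3 - β) - 2, by linarith, fun k _ hk => ?_⟩
    have : (⌊2 / (3 - β)⌋₊ : ℝ) + 1 ≤ k := by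
      exact_mod_cast (Nat.floor_lt (by positivity)).2 hk
    nlinarith
  · exact ⟨1, one_pos, fun _ h => absurd h (not_lt.2 hβ)⟩

theorem mul_zpow_neg_anti {b B : ℝ} {k : ℕ} (hb : 0 < b) (hbB : b ≤ B) (hk : 1 ≤ k) :
    (B * k) ^ (-(k : ℤ)) ≤ (b * k) ^ (-(k : ℤ)) := by
  have hk' : (0 : ℝ) < k := by exact_mod_cast hk
  rw [zpow_neg, zpow_neg, zpow_natCast, zpow_natCast]
  gcongr

theorem eventually_le_mul_log {d : ℕ → ℕ}
    (hd : (fun n => (d n : ℝ)) =o[atTop] (fun n : ℕ => Real.log (n : ℝ))) {ε : ℝ} (hε : 0 < ε) :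
    ∀ᶠ n : ℕ in atTop, (d n : ℝ) ≤ ε * Real.log n := by
  filter_upwards [hd.def hε, eventually_ge_atTop 1] with n hn hn1
  rwa [Real.norm_of_nonneg (Nat.cast_nonneg _),
    Real.norm_of_nonneg (Real.log_nonneg (by exact_mod_cast hn1))] at hn

theorem eventually_two_pow_le {d : ℕ → ℕ}
    (hd : (fun n => (d n : ℝ)) =o[atTop] (fun n : ℕ => Real.log (n : ℝ))) {ε : ℝ} (hε : 0 < ε) :
    ∀ᶠ n : ℕ in atTop, (2 : ℝ) ^ d n ≤ (n : ℝ) ^ ε := by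
  filter_upwards [eventually_le_mul_log hd hε, eventually_ge_atTop 1] with n hn hn1
  have hn0 : (0 : ℝ) < n := by exact_mod_cast hn1
  have h2 : (2 : ℝ) ≤ Real.exp 1 := by
    have := Real.add_one_le_exp (1 : ℝ)
    linarith
  calc (2 : ℝ) ^ d n ≤ Real.exp 1 ^ d n := by gcongr
    _ = Real.exp (d n) := by rw [← Real.exp_nat_mul, mul_one]
    _ ≤ Real.exp (ε * Real.log n) := Real.exp_le_exp.2 hn
    _ = (n : ℝ) ^ ε := by rw [Real.rpow_def_of_pos hn0, mul_comm]

theorem eventually_le_natCast_rpow (c : ℝ) {ε : ℝ} (hε : 0 < ε) :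
    ∀ᶠ n : ℕ in atTop, c ≤ (n : ℝ) ^ ε :=
  ((tendsto_rpow_atTop hε).comp tendsto_natCast_atTop_atTop).eventually_ge_atTop c

theorem eventually_mul_two_pow_le {d : ℕ → ℕ}
    (hd : (fun n => (d n : ℝ)) =o[atTop] (fun n : ℕ => Real.log (n : ℝ))) (c : ℝ) :
    ∀ᶠ n : ℕ in atTop, c * 2 ^ d n ≤ n := by
  filter_upwards [eventually_two_pow_le hd (show (0 : ℝ) < 1 / 2 by norm_num),
    eventually_le_natCast_rpow c (show (0 : ℝ) < 1 / 2 by norm_num)] with n h1 h2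
  calc c * 2 ^ d n ≤ (n : ℝ) ^ (1 / 2 : ℝ) * (n : ℝ) ^ (1 / 2 : ℝ) := by gcongr
    _ = n := by rw [← Real.sqrt_eq_rpow, Real.mul_self_sqrt n.cast_nonneg]

/-- Cliques of large minimal weight are negligible against the main term as long as
`d * k` is small compared to `log n`. -/
theorem rpow_le_exp_of_le_log {n d k : ℕ} {a δ p : ℝ} (hn : 1 ≤ n) (hδ : 0 < δ)
    (hp : p + δ ≤ 0) (hd : (2 : ℝ) ^ d ≤ (n : ℝ) ^ (1 / 2 : ℝ))
    (hdk : a * d * k ≤ δ / 4 * Real.log n) :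
    ((n : ℝ) / 2 ^ d) ^ (p / 2) ≤ Real.exp (-(a * d * k)) := by
  have hn1 : (1 : ℝ) ≤ n := by exact_mod_cast hn
  have hn0 : (0 : ℝ) < n := by linarith
  have h1 : (n : ℝ) ^ (1 / 2 : ℝ) ≤ n / 2 ^ d := by
    rw [le_div_iff₀ (by positivity)]
    calc (n : ℝ) ^ (1 / 2 : ℝ) * 2 ^ d ≤ (n : ℝ) ^ (1 / 2 : ℝ) * (n : ℝ) ^ (1 / 2 : ℝ) := by gcongr
      _ = n := by rw [← Real.sqrt_eq_rpow, Real.mul_self_sqrt n.cast_nonneg]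
  calc ((n : ℝ) / 2 ^ d) ^ (p / 2) ≤ ((n : ℝ) ^ (1 / 2 : ℝ)) ^ (p / 2) :=
        Real.rpow_le_rpow_of_nonpos (by positivity) h1 (by linarith)
    _ = (n : ℝ) ^ (p / 4) := by
        rw [← Real.rpow_mul hn0.le]
        congr 1
        ring
    _ ≤ (n : ℝ) ^ (-(δ / 4)) := Real.rpow_le_rpow_of_exponent_le hn1 (by linarith)
    _ = Real.exp (-(δ / 4 * Real.log n)) := by
        rw [Real.rpow_def_of_pos hn0]
        congr 1
        ring
    _ ≤ _ := Real.exp_le_exp.2 (by linarith)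

/-- For `β > 3`, the expected number of cliques of large minimal weight vanishes, whatever `k`. -/
theorem mul_rpow_le_of_three_lt {n d k : ℕ} {β C ε : ℝ} (hβ : 3 < β) (hC : 0 < C) (hn : 1 ≤ n)
    (hk : 1 ≤ k) (hε : ε = (β - 3) / (2 * (β - 1))) (hd : (2 : ℝ) ^ d ≤ (n : ℝ) ^ ε)
    (hCn : C ≤ (n : ℝ) ^ ((β - 3) / 4)) :
    n * (C / k) ^ k * ((n : ℝ) / 2 ^ d) ^ (((3 - β) * k - 2) / 2) ≤
      C * (n : ℝ) ^ (-((β - 3) / 4)) := by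
  have hn1 : (1 : ℝ) ≤ n := by exact_mod_cast hn
  have hk1 : (1 : ℝ) ≤ k := by exact_mod_cast hk
  have hn0 : (0 : ℝ) < n := by linarith
  set v : ℝ := (n : ℝ) / 2 ^ d with hv
  have hv0 : 0 < v := by positivity
  set y := v ^ ((3 - β) / 2) with hy
  have hy0 : 0 < y := by positivity
  have hvn : (n : ℝ) ^ (1 - ε) ≤ v := by
    rw [hv, le_div_iff₀ (by positivity)]
    calc (n : ℝ) ^ (1 - ε) * 2 ^ d ≤ (n : ℝ) ^ (1 - ε) * (n : ℝ) ^ ε := by gcongr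
      _ = n := by rw [← Real.rpow_add hn0, sub_add_cancel, Real.rpow_one]
  have h2y : 2 ^ d * y ≤ (n : ℝ) ^ (-((β - 3) / 4)) := by
    calc 2 ^ d * y ≤ (n : ℝ) ^ ε * ((n : ℝ) ^ (1 - ε)) ^ ((3 - β) / 2) := by
          gcongr ?_ * ?_
          exact Real.rpow_le_rpow_of_nonpos (by positivity) hvn (by linarith)
      _ = _ := by
          rw [← Real.rpow_mul hn0.le, ← Real.rpow_add hn0]
          congr 1
          have : β - 1 ≠ 0 := by linarith
          rw [hε]
          field_simp
          ring
  have hy1 : y ≤ (n : ℝ) ^ (-((β - 3) / 4)) :=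
    (le_mul_of_one_le_left hy0.le (one_le_pow₀ one_le_two)).trans h2y
  have hCy : C * y ≤ 1 := by
    calc C * y ≤ (n : ℝ) ^ ((β - 3) / 4) * (n : ℝ) ^ (-((β - 3) / 4)) := by gcongr
      _ = 1 := by rw [← Real.rpow_add hn0, add_neg_cancel, Real.rpow_zero]
  have hsplit : n * v ^ (((3 - β) * k - 2) / 2) = 2 ^ d * y ^ k := by
    have h1 : v ^ (((3 - β) * k - 2) / 2) = y ^ k * v⁻¹ := by
      rw [hy, ← Real.rpow_natCast, ← Real.rpow_mul hv0.le, ← Real.rpow_neg_one v,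
        ← Real.rpow_add hv0]
      congr 1
      ring
    rw [h1, hv]
    field_simp
  calc _ = (C / k) ^ k * (n * v ^ (((3 - β) * k - 2) / 2)) := by ring
    _ = 2 ^ d * (C / k * y) ^ k := by rw [hsplit, mul_pow]; ring
    _ ≤ 2 ^ d * (C * y) ^ k := by
        gcongr
        exact div_le_self hC.le hk1
    _ ≤ 2 ^ d * (C * y) := by
        gcongr
        exact pow_le_of_le_one (by positivity) hCy (by omega)
    _ = C * (2 ^ d * y) := by ring
    _ ≤ _ := by gcongr

/-- The two summands of `exists_expectedCliques_le_of_small` are at most the main term, up to an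
error that vanishes and is needed only for `β > 3`. -/
theorem exists_upper_error {β a C δ : ℝ} (ha : 0 < a) (hC : 0 < C) (hδ : 0 < δ)
    {d k : ℕ → ℕ}
    (hd1 : ∀ n, 1 ≤ d n) (hd : (fun n => (d n : ℝ)) =o[atTop] (fun n : ℕ => Real.log (n : ℝ)))
    (hk : ∀ n, 3 ≤ k n)
    (hk' : β = 3 → (fun n => (k n : ℝ)) =o[atTop] (fun n : ℕ => Real.log (n : ℝ) / (d n : ℝ)))
    (hgap : ∀ k : ℕ, ((β < 3 ∧ (k : ℝ) < 2 / (3 - β)) ∨ 3 ≤ β) → (3 - β) * k + δ ≤ 2) :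
    ∃ s : ℕ → ℝ, Tendsto s atTop (𝓝 0) ∧ (∀ n, 0 ≤ s n) ∧ ∀ᶠ n in atTop,
      ((β < 3 ∧ (k n : ℝ) < 2 / (3 - β)) ∨ 3 ≤ β) →
      n * (C / k n) ^ k n * (Real.exp (-(a * d n * k n)) +
        ((n : ℝ) / 2 ^ d n) ^ (((3 - β) * k n - 2) / 2)) ≤
      n * Real.exp (-(a * d n * k n)) * ((2 * C)⁻¹ * k n) ^ (-(k n : ℤ)) + s n := by
  -- the choice of the base leaves room for a factor `2`
  have hroom : ∀ n, 2 * (n * (C / k n) ^ k n * Real.exp (-(a * d n * k n))) ≤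
      n * Real.exp (-(a * d n * k n)) * ((2 * C)⁻¹ * k n) ^ (-(k n : ℤ)) := by
    intro n
    have h1 : ((2 * C)⁻¹ * k n) ^ (-(k n : ℤ)) = 2 ^ k n * (C / k n) ^ k n := by
      rw [zpow_neg, zpow_natCast, ← mul_pow, ← inv_pow, mul_inv, inv_inv]
      congr 1
      ring
    have h2 : (2 : ℝ) ≤ 2 ^ k n := le_self_pow₀ one_le_two (by have := hk n; omega)
    rw [h1]
    calc _ = n * Real.exp (-(a * d n * k n)) * (2 * (C / k n) ^ k n) := by ring
      _ ≤ _ := by gcongr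
  by_cases hβ : 3 < β
  · have hβ4 : 0 < (β - 3) / 4 := by linarith
    refine ⟨fun n => C * (n : ℝ) ^ (-((β - 3) / 4)), ?_, fun n => by positivity, ?_⟩
    · have := ((tendsto_rpow_neg_atTop hβ4).comp tendsto_natCast_atTop_atTop).const_mul C
      simpa using this
    have hε : 0 < (β - 3) / (2 * (β - 1)) := div_pos (by linarith) (by linarith)
    filter_upwards [eventually_ge_atTop 1, eventually_two_pow_le hd hε,
      eventually_le_natCast_rpow C hβ4] with n hn1 h2d hCn _
    have h1 := mul_rpow_le_of_three_lt (k := k n) hβ hC hn1 (by have := hk n; omega) rfl h2d hCn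
    have h2 : 0 ≤ n * (C / k n) ^ k n * Real.exp (-(a * d n * k n)) := by positivity
    have h3 := hroom n
    rw [mul_add]
    linarith
  · refine ⟨fun _ => 0, tendsto_const_nhds, fun _ => le_rfl, ?_⟩
    have hdk : ∀ᶠ n : ℕ in atTop, ((β < 3 ∧ (k n : ℝ) < 2 / (3 - β)) ∨ 3 ≤ β) →
        a * d n * k n ≤ δ / 4 * Real.log n := by
      rcases (not_lt.1 hβ).lt_or_eq with h3 | h3
      · have h3' : 0 < 3 - β := by linarith
        filter_upwards [eventually_le_mul_log hd
          (show 0 < δ / 4 / (a * (2 / (3 - β))) by positivity)] with n hn hcond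
        have hk2 : (k n : ℝ) ≤ 2 / (3 - β) := by
          rcases hcond with h | h
          · exact h.2.le
          · linarith
        rw [div_mul_eq_mul_div, le_div_iff₀ (by positivity)] at hn
        calc a * d n * k n ≤ a * d n * (2 / (3 - β)) := by gcongr
          _ = d n * (a * (2 / (3 - β))) := by ring
          _ ≤ _ := hn
      · filter_upwards [(hk' h3).def (show 0 < δ / 4 / a by positivity), eventually_ge_atTop 1]
          with n hn hn1 _
        have hd0 : (0 : ℝ) < d n := by exact_mod_cast hd1 n
        have hlog : 0 ≤ Real.log (n : ℝ) := Real.log_nonneg (by exact_mod_cast hn1)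
        rw [Real.norm_of_nonneg (Nat.cast_nonneg _), Real.norm_of_nonneg (by positivity),
          ← mul_div_assoc, le_div_iff₀ hd0, div_mul_eq_mul_div, le_div_iff₀ ha] at hn
        linarith
    filter_upwards [eventually_ge_atTop 1, hdk,
      eventually_two_pow_le hd (show (0 : ℝ) < 1 / 2 by norm_num)] with n hn1 hdkn h2d hcond
    have h1 := rpow_le_exp_of_le_log (p := (3 - β) * k n - 2) hn1 hδ
      (by linarith [hgap (k n) hcond]) h2d (hdkn hcond)
    have h3 := hroom n
    rw [add_zero]
    refine le_trans ?_ h3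
    calc _ ≤ n * (C / k n) ^ k n * (Real.exp (-(a * d n * k n)) + Real.exp (-(a * d n * k n))) := by
          gcongr
      _ = _ := by ring

/-- For `k` at least `n`, where there may be no cliques at all, the lower bound itself vanishes. -/
theorem small_lower_bound_le_inv {n d k : ℕ} {A B : ℝ} (hA : 0 ≤ A) (hB : 1 ≤ B) (hn : 1 ≤ n)
    (hk : 2 ≤ k) (hnk : n ≤ k) :
    (n : ℝ) * Real.exp (-(A * d * k)) * (B * k) ^ (-(k : ℤ)) ≤ (n : ℝ)⁻¹ := by
  have hn0 : (0 : ℝ) < n := by exact_mod_cast hn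
  have hnk' : (n : ℝ) ≤ k := by exact_mod_cast hnk
  have hk1 : (1 : ℝ) ≤ k := by exact_mod_cast (by omega : 1 ≤ k)
  have h1 : Real.exp (-(A * d * k)) ≤ 1 := Real.exp_le_one_iff.2 (neg_nonpos.2 (by positivity))
  have h2 : (n : ℝ) ^ 2 ≤ (B * k) ^ k := by
    calc (n : ℝ) ^ 2 ≤ (k : ℝ) ^ 2 := by gcongr
      _ ≤ (k : ℝ) ^ k := pow_le_pow_right₀ hk1 hk
      _ ≤ (B * k) ^ k := by
        gcongr
        exact le_mul_of_one_le_left (by positivity) hB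
  rw [zpow_neg, zpow_natCast]
  calc _ ≤ (n : ℝ) * 1 * ((n : ℝ) ^ 2)⁻¹ := by gcongr
    _ = _ := by field_simp

/-! ### Expected number of cliques in the two regimes -/

theorem mainTheorem4 (β w₀ lam : ℝ) (hβ : 2 < β) (hw₀ : 0 < w₀) (hlam : 0 < lam) :
    ∃ a A b B : ℝ, 0 < a ∧ 0 < A ∧ 0 < b ∧ 0 < B ∧
      ∀ d k : ℕ → ℕ,
        (∀ n, 1 ≤ d n) →
        (fun n => (d n : ℝ)) =o[atTop] (fun n : ℕ => Real.log (n : ℝ)) →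
        (∀ n, 3 ≤ k n) →
        (β = 3 → (fun n => (k n : ℝ)) =o[atTop] (fun n : ℕ => Real.log (n : ℝ) / (d n : ℝ))) →
        ∃ r : ℕ → ℝ, Tendsto r atTop (𝓝 0) ∧
          ∀ᶠ n : ℕ in atTop,
            (((β < 3 ∧ (k n : ℝ) < 2 / (3 - β)) ∨ 3 ≤ β) →
              (n : ℝ) * Real.exp (-(A * (d n : ℝ) * (k n : ℝ))) * (B * (k n : ℝ)) ^ (-(k n : ℤ))
                  ≤ expectedCliques n β w₀ lam (d n) (k n) - r n ∧
              expectedCliques n β w₀ lam (d n) (k n) - r n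
                  ≤ (n : ℝ) * Real.exp (-(a * (d n : ℝ) * (k n : ℝ))) *
                      (b * (k n : ℝ)) ^ (-(k n : ℤ))) ∧
            ((β < 3 ∧ 2 / (3 - β) < (k n : ℝ) ∧ k n ≤ n) →
              (n : ℝ) ^ ((k n : ℝ) / 2 * (3 - β)) * (B * (k n : ℝ)) ^ (-(k n : ℤ))
                  ≤ expectedCliques n β w₀ lam (d n) (k n) ∧
              expectedCliques n β w₀ lam (d n) (k n)
                  ≤ (n : ℝ) ^ ((k n : ℝ) / 2 * (3 - β)) * (b * (k n : ℝ)) ^ (-(k n : ℤ))) := by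
  classical
  obtain ⟨δ₁, hδ₁, hgap₁⟩ := exists_gap_below β
  obtain ⟨δ₂, hδ₂, hgap₂⟩ := exists_gap_above β
  obtain ⟨a, ha, C, hC, hsmall⟩ := exists_expectedCliques_le_of_small hβ hw₀ hlam hδ₁
  obtain ⟨b₂, hb₂, hlarge⟩ := exists_expectedCliques_le_of_large hβ hw₀ hlam hδ₂
  set b := min (2 * C)⁻¹ b₂
  have hb : 0 < b := lt_min (by positivity) hb₂
  set A := max 1 a
  set B₁ := (lam * w₀ * w₀)⁻¹
  set B₂ := (w₀ ^ (β - 1) * lam ^ ((β - 1) / 2))⁻¹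
  have hB₁ : 0 < B₁ := by positivity
  have hB₂ : 0 < B₂ := by positivity
  set B := 1 + b + B₁ + B₂
  have hB0 : 0 < B := by positivity
  have hB1 : 1 ≤ B := by simp only [B]; linarith
  refine ⟨a, A, b, B, ha, by positivity, hb, hB0, fun d k hd1 hd hk hk' => ?_⟩
  obtain ⟨s, hs, hs0, hup⟩ := exists_upper_error ha hC hδ₁ hd1 hd hk hk' hgap₁
  set E : ℕ → ℝ := fun n => expectedCliques n β w₀ lam (d n) (k n) with hE
  set lo : ℕ → ℝ := fun n =>
    (n : ℝ) * Real.exp (-(A * (d n : ℝ) * (k n : ℝ))) * (B * (k n : ℝ)) ^ (-(k n : ℤ)) with hlo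
  set up : ℕ → ℝ := fun n =>
    (n : ℝ) * Real.exp (-(a * (d n : ℝ) * (k n : ℝ))) * (b * (k n : ℝ)) ^ (-(k n : ℤ)) with hupdef
  have hlu : ∀ n, lo n ≤ up n := by
    intro n
    simp only [hlo, hupdef]
    gcongr
    · exact le_max_right _ _
    · exact mul_zpow_neg_anti hb (by simp only [B]; linarith) (by have := hk n; omega)
  -- the error is the distance of `E n` to the interval between the two bounds
  set r : ℕ → ℝ := fun n => if (β < 3 ∧ (k n : ℝ) < 2 / (3 - β)) ∨ 3 ≤ β then
    E n - max (lo n) (min (E n) (up n)) else 0 with hr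
  have hev := eventually_mul_two_pow_le hd (lam * w₀ * w₀)
  have hbounds : ∀ᶠ n in atTop, ((β < 3 ∧ (k n : ℝ) < 2 / (3 - β)) ∨ 3 ≤ β) →
      lo n ≤ E n + (n : ℝ)⁻¹ ∧ E n ≤ up n + s n := by
    filter_upwards [hup, hev, eventually_ge_atTop 1] with n hupn hevn hn1 hcond
    have hk1 : 1 ≤ k n := by have := hk n; omega
    have hn' : lam * w₀ * w₀ ≤ n :=
      (le_mul_of_one_le_right (by positivity) (one_le_pow₀ one_le_two)).trans hevn
    constructor
    · rcases le_or_gt (k n) n with hkn | hkn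
      · have h1 := le_expectedCliques_of_small hβ hw₀ hlam (hd1 n) hn1 hk1 hkn hn' hB1
          (show B₁ ≤ B by simp only [B]; linarith)
        have h2 : lo n ≤ (n : ℝ) * Real.exp (-(1 * d n * k n)) * (B * k n) ^ (-(k n : ℤ)) := by
          simp only [hlo]
          gcongr
          exact le_max_left _ _
        have h3 : (0 : ℝ) ≤ (n : ℝ)⁻¹ := by positivity
        simp only [hE]
        linarith
      · have h1 : lo n ≤ (n : ℝ)⁻¹ := small_lower_bound_le_inv (by positivity) hB1 hn1
          (by have := hk n; omega) hkn.le
        have h2 : 0 ≤ E n := integral_nonneg fun _ => Nat.cast_nonneg _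
        linarith
    · have h1 := hsmall n (d n) (k n) hn1 (hd1 n) (hk n) hevn (hgap₁ _ hcond)
      have h2 := hupn hcond
      have h3 : (n : ℝ) * Real.exp (-(a * d n * k n)) * ((2 * C)⁻¹ * k n) ^ (-(k n : ℤ)) ≤ up n := by
        simp only [hupdef]
        gcongr ?_ * ?_
        exact mul_zpow_neg_anti hb (min_le_left _ _) hk1
      simp only [hE]
      linarith
  refine ⟨r, ?_, ?_⟩
  · have hlim : Tendsto (fun n : ℕ => s n + (n : ℝ)⁻¹) atTop (𝓝 0) := by
      simpa using hs.add (tendsto_inv_atTop_nhds_zero_nat (𝕜 := ℝ))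
    refine squeeze_zero_norm' ?_ hlim
    filter_upwards [hbounds] with n hn
    have h3 : (0 : ℝ) ≤ (n : ℝ)⁻¹ := by positivity
    have h4 := hs0 n
    have h5 := hlu n
    simp only [hr]
    split_ifs with hcond
    · obtain ⟨h1, h2⟩ := hn hcond
      rw [Real.norm_eq_abs, abs_le]
      constructor
      · have : max (lo n) (min (E n) (up n)) ≤ E n + (n : ℝ)⁻¹ :=
          max_le h1 ((min_le_left _ _).trans (by linarith))
        linarith
      · have : E n - s n ≤ min (E n) (up n) := le_min (by linarith) (by linarith)
        have := this.trans (le_max_right (lo n) _)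
        linarith
    · rw [norm_zero]
      positivity
  · filter_upwards [hev, eventually_ge_atTop 1] with n hevn hn1
    have hk1 : 1 ≤ k n := by have := hk n; omega
    have hn' : lam * w₀ * w₀ ≤ n :=
      (le_mul_of_one_le_right (by positivity) (one_le_pow₀ one_le_two)).trans hevn
    constructor
    · intro hcond
      have : expectedCliques n β w₀ lam (d n) (k n) - r n = max (lo n) (min (E n) (up n)) := by
        simp only [hr, if_pos hcond, hE, sub_sub_cancel]
      rw [this]
      exact ⟨le_max_left _ _, max_le (hlu n) (min_le_right _ _)⟩
    · rintro ⟨h3, h2k, hkn⟩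
      refine ⟨le_expectedCliques_of_large hβ hw₀ hlam hn1 hk1 hkn hn'
        (show B₂ ≤ B by simp only [B]; linarith), ?_⟩
      refine (hlarge n (d n) (k n) hn1 (hd1 n) hk1 hn' (hgap₂ _ h3 h2k)).trans ?_
      gcongr ?_ * ?_
      exact mul_zpow_neg_anti hb (min_le_right _ _) hk1
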